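/- **Theorem.** Let $\Sigma$ be a connected smooth surface (a connected, Hausdorff, second countable smooth $2$-manifold) with a smooth immersion $f:\Sigma\to\mathbb R^4$, complete in the induced Riemannian metric, and let $\Pi\subset\mathbb R^4$ be a two-dimensional linear subspace. The principal angles $0\le\theta_1\le\theta_2\le\pi/2$ between the plane $T_p\Sigma$ (the image of $df_p$) and $\Pi$ are given by $$\cos\theta_1=\langle v_1,w_1\rangle=\max\{\langle v,w\rangle : v\in T_p\Sigma,\ w\in\Pi,\ |v|=|w|=1\},$$ $$\cos\theta_2=\max\{\langle v,w\rangle : v\in T_p\Sigma,\ w\in\Pi,\ v\perp v_1,\ w\perp w_1,\ |v|=|w|=1\}.$$ Assume that they do not depend on $p\in\Sigma$, that $\theta_1=0$, and that $\Sigma$ is not totally geodesic (its second fundamental form does not vanish identically). Let $S_p$ be the symmetric endomorphism of $T_p\Sigma$ with $\langle S_p v,v'\rangle=\langle p_\Pi(v),p_\Pi(v')\rangle$, where $p_\Pi$ is the orthogonal projection onto $\Pi$. A principal frame on an open set $U\subset\Sigma$ is a pair $T_1,T_2$ of smooth tangent vector fields on $U$, orthonormal at each point, with $S T_1=\cos^2\theta_1\,T_1$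 and $S T_2=\cos^2\theta_2\,T_2$. Then: 1. Principal frames exist in a neighbourhood of every point, and for every principal frame $T_1,T_2$ on an open set $U$ the fields $T_1$ and $T_2$ are parallel for the Levi-Civita connection of the induced metric. 2. Consequently $\Sigma$ is an extrinsic product of two curves, in the following sense: there are a linear subspace $V\subset\mathbb R^4$, smooth curves $\gamma_1:\mathbb R\to V$ and $\gamma_2:\mathbb R\to V^\perp$ parametrized by arc length, and a smooth surjective covering map $\pi:\mathbb R^2\to\Sigma$ with $$f(\pi(s,t))=\gamma_1(s)+\gamma_2(t)\qquad\text{for all } s,t\in\mathbb R .$$ In particular $f(\Sigma)=\gamma_1(\mathbb R)\times\gamma_2(\mathbb R)\subset V\oplus V^\perp=\mathbb R^4$. -/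

import Mathlib

open scoped Manifold ContDiff RealInnerProductSpace Topology

noncomputable section

/-- Euclidean four-space. -/
abbrev E4 : Type := EuclideanSpace ℝ (Fin 4)

/-! ### Principal angles between planes -/

/-- `θ₁ ≤ θ₂` are the principal angles between the planes `V` and `W`: the number `cos θ₁` is the
maximum of `⟪v, w⟫` over unit vectors `v ∈ V`, `w ∈ W`, it is attained at `(v₁, w₁)`, and `cos θ₂`
is the maximum of `⟪v, w⟫` over unit vectors `v ∈ V`, `w ∈ W` with `v ⟂ v₁` and `w ⟂ w₁`. -/
def IsPrincipalAngles (V W : Submodule ℝ E4) (θ₁ θ₂ : ℝ) : Prop :=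
  0 ≤ θ₁ ∧ θ₁ ≤ θ₂ ∧ θ₂ ≤ Real.pi / 2 ∧
  IsGreatest {c : ℝ | ∃ v ∈ V, ∃ w ∈ W, ‖v‖ = 1 ∧ ‖w‖ = 1 ∧ c = ⟪v, w⟫} (Real.cos θ₁) ∧
  ∃ v₁ ∈ V, ∃ w₁ ∈ W, ‖v₁‖ = 1 ∧ ‖w₁‖ = 1 ∧ Real.cos θ₁ = ⟪v₁, w₁⟫ ∧
    IsGreatest {c : ℝ | ∃ v ∈ V, ∃ w ∈ W, ⟪v, v₁⟫ = 0 ∧ ⟪w, w₁⟫ = 0 ∧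
      ‖v‖ = 1 ∧ ‖w‖ = 1 ∧ c = ⟪v, w⟫} (Real.cos θ₂)

/-- The symmetric endomorphism `S` of `V` with `⟪S v, v'⟫ = ⟪p_W v, p_W v'⟫`, where `p_W` is the
orthogonal projection onto `W` (see `inner_principalOperator`). -/
def principalOperator (W V : Submodule ℝ E4) : V →L[ℝ] V :=
  V.orthogonalProjectionOnto ∘L W.starProjection ∘L V.subtypeL

theorem inner_principalOperator (W V : Submodule ℝ E4) (v v' : V) :
    ⟪principalOperator W V v, v'⟫ = ⟪W.starProjection (v : E4), W.starProjection (v' : E4)⟫ := by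
  rw [← Submodule.inner_starProjection_left_eq_right,
    W.starProjection_eq_self_iff.mpr (W.starProjection_apply_mem _)]
  simp [principalOperator]

/-! ### Immersed surfaces in four-space

A surface is a 2-manifold `M` with a map `f : M → E4` (a smooth immersion). -/

section Surface

variable {M : Type*} [TopologicalSpace M] [ChartedSpace (EuclideanSpace ℝ (Fin 2)) M]

/-- The differential of `f` at `p`, with values in `E4`. -/
def surfDiff (f : M → E4) (p : M) : TangentSpace (𝓡 2) p →L[ℝ] E4 :=
  mfderiv (𝓡 2) 𝓘(ℝ, E4) f p

/-- The tangent plane of the immersed surface at `p`, as a linear subspace of `E4`. -/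
def tangentPlane (f : M → E4) (p : M) : Submodule ℝ E4 :=
  (surfDiff f p).toLinearMap.range

/-- A tangent vector of `M` at `p`, seen as an element of the tangent plane in `E4`. -/
def toTangentPlane (f : M → E4) (p : M) (v : TangentSpace (𝓡 2) p) : tangentPlane f p :=
  ⟨surfDiff f p v, ⟨v, rfl⟩⟩

/-- The distance of the induced Riemannian metric `f^*⟪·, ·⟫`: the infimum of the lengths of
`C^1` paths in `M`, where a tangent vector `v` has length `‖df v‖`. -/
def inducedEDist (f : M → E4) (x y : M) : ENNReal :=
  letI : ∀ p : M, ENorm (TangentSpace (𝓡 2) p) := fun p => ⟨fun v => ‖surfDiff f p v‖ₑ⟩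
  Manifold.riemannianEDist (𝓡 2) x y

/-- The surface is complete in its induced metric: Cauchy sequences converge. -/
def IsCompleteSurface (f : M → E4) : Prop :=
  ∀ u : ℕ → M,
    (∀ ε : ENNReal, 0 < ε → ∃ N : ℕ, ∀ m ≥ N, ∀ n ≥ N, inducedEDist f (u m) (u n) < ε) →
    ∃ x : M, Filter.Tendsto u Filter.atTop (𝓝 x)

/-- The surface has constant principal angles `θ₁ ≤ θ₂` with respect to the plane `P`. -/
def HasConstantPrincipalAngles (f : M → E4) (P : Submodule ℝ E4) (θ₁ θ₂ : ℝ) : Prop :=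
  ∀ p : M, IsPrincipalAngles (tangentPlane f p) P θ₁ θ₂

/-- `T` is a smooth tangent vector field on the set `U`. -/
def IsSmoothField [IsManifold (𝓡 2) ∞ M] (U : Set M) (T : ∀ p : M, TangentSpace (𝓡 2) p) : Prop :=
  ContMDiffOn (𝓡 2) (𝓡 2).tangent ∞ (fun p => (⟨p, T p⟩ : TangentBundle (𝓡 2) M)) U

/-- The derivative `D_X T` in `E4` of the tangent field `T` in the direction `X` at `p`. -/
def ambientDeriv (f : M → E4) (T : ∀ p : M, TangentSpace (𝓡 2) p) (p : M)
    (X : TangentSpace (𝓡 2) p) : E4 :=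
  mfderiv (𝓡 2) 𝓘(ℝ, E4) (fun q => surfDiff f q (T q)) p X

/-- The Levi-Civita derivative `∇_X T` of the induced metric: the tangential part of `D_X T`. -/
def leviCivita (f : M → E4) (T : ∀ p : M, TangentSpace (𝓡 2) p) (p : M)
    (X : TangentSpace (𝓡 2) p) : E4 :=
  (tangentPlane f p).starProjection (ambientDeriv f T p X)

/-- The second fundamental form `α(X, T)`: the normal part of `D_X T`. -/
def secondFundamentalForm (f : M → E4) (T : ∀ p : M, TangentSpace (𝓡 2) p) (p : M)
    (X : TangentSpace (𝓡 2) p) : E4 :=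
  (tangentPlane f p)ᗮ.starProjection (ambientDeriv f T p X)

/-- The second fundamental form vanishes identically. -/
def IsTotallyGeodesic [IsManifold (𝓡 2) ∞ M] (f : M → E4) : Prop :=
  ∀ (U : Set M) (T : ∀ p : M, TangentSpace (𝓡 2) p), IsOpen U → IsSmoothField U T →
    ∀ p ∈ U, ∀ X : TangentSpace (𝓡 2) p, secondFundamentalForm f T p X = 0

/-- `T` is a parallel field on the open set `U`: `∇ T = 0`. -/
def IsParallelOn (f : M → E4) (U : Set M) (T : ∀ p : M, TangentSpace (𝓡 2) p) : Prop :=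
  ∀ p ∈ U, ∀ X : TangentSpace (𝓡 2) p, leviCivita f T p X = 0

/-- `T₁, T₂` is a smooth principal frame on `U` for the principal angles `θ₁, θ₂` with respect to
`P`: an orthonormal frame (for the induced metric) of eigenvectors of the principal operator, with
eigenvalues `cos² θ₁` and `cos² θ₂`. -/
structure IsPrincipalFrame [IsManifold (𝓡 2) ∞ M] (f : M → E4) (P : Submodule ℝ E4) (θ₁ θ₂ : ℝ)
    (U : Set M) (T₁ T₂ : ∀ p : M, TangentSpace (𝓡 2) p) : Prop where
  smooth₁ : IsSmoothField U T₁
  smooth₂ : IsSmoothField U T₂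
  orthonormal : ∀ p ∈ U, Orthonormal ℝ ![surfDiff f p (T₁ p), surfDiff f p (T₂ p)]
  eigen₁ : ∀ p ∈ U, principalOperator P (tangentPlane f p) (toTangentPlane f p (T₁ p)) =
    Real.cos θ₁ ^ 2 • toTangentPlane f p (T₁ p)
  eigen₂ : ∀ p ∈ U, principalOperator P (tangentPlane f p) (toTangentPlane f p (T₂ p)) =
    Real.cos θ₂ ^ 2 • toTangentPlane f p (T₂ p)

/-- A complete immersed surface is an extrinsic product of two curves: there are an orthogonal
splitting `E4 = V ⊕ Vᗮ`, smooth curves `γ₁` in `V` and `γ₂` in `Vᗮ`, defined on all of `ℝ` and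
parametrized by arc length, and a smooth surjective covering `π : ℝ × ℝ → M` through which the
immersion becomes the product `γ₁ × γ₂ : ℝ × ℝ → V × Vᗮ`.
In particular the surface `f(M)` is the set `γ₁(ℝ) × γ₂(ℝ)`; if `M` is simply connected then `π` is
a diffeomorphism, and if `f` is injective then `M` itself is the product of the two (embedded or
closed) curves, since then `π (s, t)` determines and is determined by `(γ₁ s, γ₂ t)`.
For a non-injective immersion of a surface that is not simply connected the covering is needed: the
double covering of the torus `S¹ × S¹` by `ℝ² / 2π{(a, b) ∈ ℤ² | a + b even}` is an example. -/
def IsExtrinsicProduct (f : M → E4) : Prop :=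
  ∃ (V : Submodule ℝ E4) (γ₁ γ₂ : ℝ → E4) (π : ℝ × ℝ → M),
    (∀ s, γ₁ s ∈ V) ∧ (∀ t, γ₂ t ∈ Vᗮ) ∧
    ContDiff ℝ ∞ γ₁ ∧ ContDiff ℝ ∞ γ₂ ∧
    (∀ s, ‖deriv γ₁ s‖ = 1) ∧ (∀ t, ‖deriv γ₂ t‖ = 1) ∧
    ContMDiff 𝓘(ℝ, ℝ × ℝ) (𝓡 2) ∞ π ∧ IsCoveringMap π ∧ Function.Surjective π ∧
    ∀ s t, f (π (s, t)) = γ₁ s + γ₂ t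

end Surface

end

/-! Put `C = cos θ₂`. Since `θ₁ = 0`, every tangent plane has an orthonormal basis `v₁, v₂` with `v₁
∈ P` and `‖p_P v₂‖ = C` (`IsPrincipalAngles.exists_isPrincipalBasis`). If `C = 1`, all tangent
planes equal `P` and the surface is totally geodesic, so `C < 1`. Everything then rests on one
global fact (`exists_splitting`): there is a fixed subspace `V` with `v₁ ∈ V` and `v₂ ∈ Vᗮ` at every
point.

For `C = 0`, `V = P` works. For `0 < C < 1` the projection of the surface to `P` is a local
diffeomorphism that shrinks lengths at most by the factor `C`, so completeness gives global sections
`σ : P → M` (`exists_global_section`). Up to a translation in `P`, `f ∘ σ` is the graph of a map `u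
: P → Pᗮ` whose differential has rank one and constant norm `k = √(1 - C²) / C`, with kernel spanned
by `v₁`. Such a kernel is constant (`fderiv_apply_eq_zero_of_rankOne`): if `v` is a unit kernel
vector and `e` a unit vector orthogonal to it, constancy of the norm and vanishing of the 2×2 minors
force `D²u(e, v) = 0`, so the kernel direction persists along the straight line in direction `e`.
Two such lines carrying different kernels would meet at a point where `du = 0`, which is impossible.
Hence `v₁` is constant up to sign, and `V` is its span.

Given the splitting, a unit tangent field `W` in `V` or in `Vᗮ` has derivative normal to the
surface: it is orthogonal to `W` because `W` has length one, and to the other principal direction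
because it stays in its subspace. This is the parallelism of principal frames. It also makes the
forms `⟪W, df⟫` closed; their primitives are local coordinates in which `f` is a sum of a unit speed
curve in `V` and one in `Vᗮ` (`exists_flat_product_chart`). Changes between such coordinates are
locally translations combined with reflections of the axes, so product maps from the plane are
determined by their germs, and completeness continues them to all of `ℝ × ℝ`
(`exists_global_product_map`). Over a chart with image a ball, the global map is a disjoint union of
isometric copies of that ball, hence a covering; connectedness makes it surjective. Projecting `f ∘
π` on the two axes to `V` and `Vᗮ` gives the curves. -/

noncomputable section

/-! ### Continuation of locally determined maps along rays -/

section Continuation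

open Metric Set


/-- Two maps with a property whose germs are determined by nearby germs agree on a preconnected set
as soon as their germs agree at one of its points. -/
theorem eventuallyEq_of_isPreconnected {E Y : Type*} [TopologicalSpace E] {Q : (E → Y) → E → Prop}
    (huniq : ∀ g g' x, Q g x → Q g' x → (∃ᶠ y in 𝓝 x, g =ᶠ[𝓝 y] g') → g =ᶠ[𝓝 x] g')
    {S : Set E} (hS : IsPreconnected S) {g g' : E → Y} (hg : ∀ x ∈ S, Q g x)
    (hg' : ∀ x ∈ S, Q g' x) {x₀ : E} (hx₀ : x₀ ∈ S) (h : g =ᶠ[𝓝 x₀] g') :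
    ∀ x ∈ S, g =ᶠ[𝓝 x] g' := by
  have key : S ⊆ {x | g =ᶠ[𝓝 x] g'} := by
    refine hS.subset_of_closure_inter_subset ?_ ⟨x₀, hx₀, h⟩ ?_
    · exact isOpen_setOfPred_eventually_nhds
    · rintro x ⟨hx, hxS⟩
      exact huniq g g' x (hg x hxS) (hg' x hxS) (mem_closure_iff_frequently.mp hx)
  exact key

/-- Analytic continuation for an abstract local property `Q`, applied below to sections over `P` and
to product maps. Rays from the origin suffice because the domain is simply connected in the
strongest sense: continuations on convex neighbourhoods of `0` agree on overlaps, so no monodromy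
arises. The hypothesis `hext` is where completeness enters: a solution along a half-open segment can
be restarted on a ball that contains the endpoint. -/
theorem exists_global_continuation {E Y : Type*} [NormedAddCommGroup E] [NormedSpace ℝ E]
    {Q : (E → Y) → E → Prop}
    (hloc : ∀ g g' x, g =ᶠ[𝓝 x] g' → Q g x → Q g' x)
    (huniq : ∀ g g' x, Q g x → Q g' x → (∃ᶠ y in 𝓝 x, g =ᶠ[𝓝 y] g') → g =ᶠ[𝓝 x] g')
    (hext : ∀ g z, (∀ τ ∈ Ico (0 : ℝ) 1, Q g (τ • z)) → ∃ τ ∈ Ico (0 : ℝ) 1, ∃ g' r,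
      ‖z - τ • z‖ < r ∧ (∀ x ∈ ball (τ • z) r, Q g' x) ∧ g' =ᶠ[𝓝 (τ • z)] g)
    {g₀ : E → Y} {r₀ : ℝ} (hr₀ : 0 < r₀) (hg₀ : ∀ x ∈ ball 0 r₀, Q g₀ x) :
    ∃ g, (∀ x, Q g x) ∧ g =ᶠ[𝓝 0] g₀ := by
  -- Convexity of `N` makes the overlap of two domains preconnected and containing `0`, so the
  -- choices `G x` glue to a single map.
  let D : Set E := {x | ∃ N : Set E, IsOpen N ∧ Convex ℝ N ∧ 0 ∈ N ∧ x ∈ N ∧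
    ∃ g, (∀ y ∈ N, Q g y) ∧ g =ᶠ[𝓝 0] g₀}
  have hD : ∀ x, x ∈ D → ∃ N : Set E, IsOpen N ∧ Convex ℝ N ∧ 0 ∈ N ∧ x ∈ N ∧
    ∃ g, (∀ y ∈ N, Q g y) ∧ g =ᶠ[𝓝 0] g₀ := fun x hx => hx
  have : Nonempty Y := ⟨g₀ 0⟩
  choose! N hNo hNc h0N hxN G hG hG0 using hD
  let g : E → Y := fun x => G x x
  have hDopen : IsOpen D := isOpen_iff_mem_nhds.mpr fun x hx =>
    Filter.mem_of_superset ((hNo x hx).mem_nhds (hxN x hx)) fun y hy =>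
      ⟨N x, hNo x hx, hNc x hx, h0N x hx, hy, G x, hG x hx, hG0 x hx⟩
  have hgeq : ∀ x ∈ D, g =ᶠ[𝓝 x] G x := by
    intro x hx
    filter_upwards [(hNo x hx).mem_nhds (hxN x hx), hDopen.mem_nhds hx] with y hy hyD
    refine (eventuallyEq_of_isPreconnected huniq
      ((hNc y hyD).inter (hNc x hx)).isPreconnected (fun z hz => hG y hyD z hz.1)
      (fun z hz => hG x hx z hz.2) ⟨h0N y hyD, h0N x hx⟩
      ((hG0 y hyD).trans (hG0 x hx).symm) y ⟨hxN y hyD, hy⟩).self_of_nhds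
  have hgD : ∀ x ∈ D, Q g x := fun x hx => hloc _ _ _ (hgeq x hx).symm (hG x hx x (hxN x hx))
  have h0D : (0 : E) ∈ D := ⟨ball 0 r₀, isOpen_ball, convex_ball 0 r₀, mem_ball_self hr₀,
    mem_ball_self hr₀, g₀, hg₀, Filter.EventuallyEq.rfl⟩
  have hg0 : g =ᶠ[𝓝 0] g₀ := (hgeq 0 h0D).trans (hG0 0 h0D)
  have hstar : ∀ x ∈ D, ∀ τ ∈ Icc (0 : ℝ) 1, τ • x ∈ D := by
    intro x hx τ hτ
    refine ⟨N x, hNo x hx, hNc x hx, h0N x hx, ?_, G x, hG x hx, hG0 x hx⟩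
    exact (hNc x hx).smul_mem_of_zero_mem (h0N x hx) (hxN x hx) hτ
  have step : ∀ z, (∀ τ ∈ Ico (0 : ℝ) 1, τ • z ∈ D) → z ∈ D := by
    intro z hz
    obtain ⟨τ, hτ, g', r, hr, hg', hgg'⟩ := hext g z fun τ hτ => hgD _ (hz τ hτ)
    have hKD : segment ℝ 0 (τ • z) ⊆ D := by
      rw [segment_eq_image']
      rintro _ ⟨s, hs, rfl⟩
      simpa using hstar _ (hz τ hτ) s hs
    have hKc : IsCompact (segment ℝ 0 (τ • z)) := by
      rw [segment_eq_image']
      exact isCompact_Icc.image (by fun_prop)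
    obtain ⟨δ, hδ, hδD⟩ := hKc.exists_thickening_subset_open hDopen hKD
    set K := thickening δ (segment ℝ 0 (τ • z)) with hK
    have hKopen : IsOpen K := isOpen_thickening
    have hKconv : Convex ℝ K := (convex_segment _ _).thickening δ
    have hself : ∀ x ∈ segment ℝ 0 (τ • z), x ∈ K := fun x hx =>
      self_subset_thickening hδ _ hx
    have hrpos : 0 < r := (norm_nonneg _).trans_lt hr
    have hagree : ∀ y ∈ K ∩ ball (τ • z) r, g' y = g y := fun y hy =>
      (eventuallyEq_of_isPreconnected huniq
        (hKconv.inter (convex_ball (τ • z) r)).isPreconnected (fun x hx => hg' x hx.2)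
        (fun x hx => hgD x (hδD hx.1)) ⟨hself _ (right_mem_segment _ _ _), mem_ball_self hrpos⟩
        hgg' y hy).self_of_nhds
    classical
    let g'' : E → Y := fun y => if y ∈ K then g y else g' y
    have h1 : ∀ y ∈ K, g'' =ᶠ[𝓝 y] g := fun y hy => by
      filter_upwards [hKopen.mem_nhds hy] with x hx
      simp [g'', hx]
    have h2 : ∀ y ∈ ball (τ • z) r, g'' =ᶠ[𝓝 y] g' := fun y hy => by
      filter_upwards [isOpen_ball.mem_nhds hy] with x hx
      by_cases hxK : x ∈ K
      · simp [g'', hxK, hagree x ⟨hxK, hx⟩]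
      · simp [g'', hxK]
    -- This radius lets the two pieces cover a thickening of the whole segment from `0` to `z`:
    -- points near `s • z` with `s ≤ τ` lie in `K`, those with `s ≥ τ` lie in the ball about `τ •
    -- z`.
    set δ' := min δ (r - ‖z - τ • z‖) with hδ'
    have hδ'pos : 0 < δ' := lt_min hδ (by linarith)
    refine ⟨thickening δ' (segment ℝ 0 z), isOpen_thickening, (convex_segment _ _).thickening δ',
      self_subset_thickening hδ'pos _ (left_mem_segment _ _ _),
      self_subset_thickening hδ'pos _ (right_mem_segment _ _ _), g'', ?_,
      (h1 0 (hself _ (left_mem_segment _ _ _))).trans hg0⟩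
    intro y hy
    obtain ⟨w, hw, hyw⟩ := mem_thickening_iff.mp hy
    rw [segment_eq_image'] at hw
    obtain ⟨s, hs, rfl⟩ := hw
    simp only [sub_zero, zero_add] at hyw
    rcases le_total s τ with hsτ | hsτ
    · have hyK : y ∈ K := by
        refine mem_thickening_iff.mpr ⟨s • z, ?_, hyw.trans_le (min_le_left _ _)⟩
        rw [segment_eq_image']
        rcases eq_or_lt_of_le hτ.1 with h | h
        · refine ⟨0, by simp, ?_⟩
          have : s = 0 := le_antisymm (h ▸ hsτ) hs.1
          simp [this]
        · refine ⟨s / τ, ⟨div_nonneg hs.1 h.le, (div_le_one h).mpr hsτ⟩, ?_⟩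
          simp [smul_smul, div_mul_cancel₀ _ h.ne']
      exact hloc _ _ _ (h1 y hyK).symm (hgD y (hδD hyK))
    · have hyB : y ∈ ball (τ • z) r := by
        have h3 : dist (s • z) (τ • z) ≤ ‖z - τ • z‖ := by
          rw [dist_eq_norm, ← sub_smul, show z - τ • z = (1 - τ) • z by rw [sub_smul, one_smul],
            norm_smul, norm_smul, Real.norm_of_nonneg (by linarith),
            Real.norm_of_nonneg (by linarith [hτ.2])]
          gcongr
          exact hs.2
        have h4 : δ' ≤ r - ‖z - τ • z‖ := min_le_right _ _
        have := dist_triangle y (s • z) (τ • z)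
        rw [mem_ball]
        linarith
      exact hloc _ _ _ (h2 y hyB).symm (hg' y hyB)
  suffices h : ∀ z, z ∈ D from ⟨g, fun x => hgD x (h x), hg0⟩
  intro z
  let I : Set ℝ := {τ | τ ∈ Icc (0 : ℝ) 1 ∧ τ • z ∈ D}
  have hI0 : (0 : ℝ) ∈ I := ⟨by simp, by simpa using h0D⟩
  have hIb : BddAbove I := ⟨1, fun τ hτ => hτ.1.2⟩
  set b := sSup I
  have hb0 : 0 ≤ b := le_csSup hIb hI0
  have hb1 : b ≤ 1 := csSup_le ⟨0, hI0⟩ fun τ hτ => hτ.1.2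
  have hlt : ∀ τ, 0 ≤ τ → τ < b → τ • z ∈ D := by
    intro τ h0 hτ
    obtain ⟨s, hs, hτs⟩ := exists_lt_of_lt_csSup ⟨0, hI0⟩ hτ
    have hspos : 0 < s := h0.trans_lt hτs
    have := hstar _ hs.2 (τ / s) ⟨div_nonneg h0 hspos.le, (div_le_one hspos).mpr hτs.le⟩
    rwa [smul_smul, div_mul_cancel₀ _ hspos.ne'] at this
  have hbD : b • z ∈ D := by
    refine step _ fun τ hτ => ?_
    rw [smul_smul]
    rcases eq_or_lt_of_le hb0 with h | h
    · simpa [← h] using h0D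
    · exact hlt _ (mul_nonneg hτ.1 hb0) (by nlinarith [hτ.2])
  rcases eq_or_lt_of_le hb1 with h | h
  · simpa [h] using hbD
  · exfalso
    have hcont : ContinuousAt (fun τ : ℝ => τ • z) b := by fun_prop
    have hev : ∀ᶠ τ in 𝓝 b, τ • z ∈ D := hcont.eventually (hDopen.mem_nhds hbD)
    obtain ⟨ε, hε, hball⟩ := Metric.eventually_nhds_iff.mp hev
    have hτ : min 1 (b + ε / 2) ∈ I := by
      refine ⟨⟨le_min zero_le_one (by linarith), min_le_left _ _⟩, hball ?_⟩
      rw [Real.dist_eq, abs_of_nonneg (sub_nonneg.mpr (le_min hb1 (by linarith)))]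
      have := min_le_right 1 (b + ε / 2)
      linarith
    have h5 := le_csSup hIb hτ
    have : b < min 1 (b + ε / 2) := lt_min h (by linarith)
    linarith

end Continuation

end
noncomputable section

/-! ### Two-dimensional inner product spaces -/

section Plane

variable {F : Type*} [NormedAddCommGroup F] [InnerProductSpace ℝ F]

theorem exists_unit_inner_eq_zero (hF : Module.finrank ℝ F = 2) (e : F) :
    ∃ v : F, ‖v‖ = 1 ∧ ⟪e, v⟫ = 0 := by
  have : FiniteDimensional ℝ F := Module.finite_of_finrank_pos (by omega)
  have h1 := Submodule.finrank_add_finrank_orthogonal (ℝ ∙ e)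
  have h2 : Module.finrank ℝ (ℝ ∙ e) ≤ 1 := by
    simpa using finrank_span_le_card (R := ℝ) ({e} : Set F)
  have h3 : 0 < Module.finrank ℝ (ℝ ∙ e)ᗮ := by omega
  have := Module.finrank_pos_iff.mp h3
  obtain ⟨⟨w, hw⟩, hne⟩ := exists_ne (0 : (ℝ ∙ e)ᗮ)
  have hw0 : w ≠ 0 := fun h => hne (Subtype.ext h)
  have hwe := Submodule.mem_orthogonal_singleton_iff_inner_right.mp hw
  refine ⟨‖w‖⁻¹ • w, ?_, by rw [inner_smul_right, hwe, mul_zero]⟩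
  rw [norm_smul, norm_inv, norm_norm, inv_mul_cancel₀ (norm_ne_zero_iff.mpr hw0)]

theorem eq_inner_smul_add_inner_smul (hF : Module.finrank ℝ F = 2) {e v : F} (he : ‖e‖ = 1)
    (hv : ‖v‖ = 1) (hev : ⟪e, v⟫ = 0) (a : F) : a = ⟪e, a⟫ • e + ⟪v, a⟫ • v := by
  have : FiniteDimensional ℝ F := Module.finite_of_finrank_pos (by omega)
  have ho : Orthonormal ℝ ![e, v] := by
    rw [orthonormal_vecCons_iff]
    simp [he, hv, hev]
  have hspan : ⊤ ≤ Submodule.span ℝ (Set.range ![e, v]) :=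
    (ho.linearIndependent.span_eq_top_of_card_eq_finrank' (by simp [hF])).ge
  have := (OrthonormalBasis.mk ho hspan).sum_repr' a
  simpa [Fin.sum_univ_two] using this.symm

theorem inner_mul_inner_add (hF : Module.finrank ℝ F = 2) {e v : F} (he : ‖e‖ = 1)
    (hv : ‖v‖ = 1) (hev : ⟪e, v⟫ = 0) (a b : F) :
    ⟪e, a⟫ * ⟪e, b⟫ + ⟪v, a⟫ * ⟪v, b⟫ = ⟪a, b⟫ := by
  conv_rhs => rw [eq_inner_smul_add_inner_smul hF he hv hev a]
  rw [inner_add_left, real_inner_smul_left, real_inner_smul_left]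

end Plane

/-! ### Maps of the plane with a differential of rank one and constant norm -/

section RankOne

variable {P N : Type*} [NormedAddCommGroup P] [InnerProductSpace ℝ P]
  [NormedAddCommGroup N] [InnerProductSpace ℝ N]

/-- If the differential of `u` has rank one and constant norm, then its derivative at a point
vanishes on the pair formed by the normal to the kernel and the kernel. -/
theorem fderiv_fderiv_eq_zero_of_rankOne (hP : Module.finrank ℝ P = 2) {u : P → N}
    (hu : ContDiff ℝ 2 u) {k : ℝ} (hk : k ≠ 0)
    (hA : ∀ y, ∃ e n, ‖e‖ = 1 ∧ ‖n‖ = 1 ∧ ∀ a, fderiv ℝ u y a = (k * ⟪e, a⟫) • n)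
    {x e v : P} {n : N} (he : ‖e‖ = 1) (hv : ‖v‖ = 1) (hev : ⟪e, v⟫ = 0) (hn : ‖n‖ = 1)
    (hx : ∀ a, fderiv ℝ u x a = (k * ⟪e, a⟫) • n) :
    fderiv ℝ (fderiv ℝ u) x e v = 0 := by
  have hd : Differentiable ℝ (fderiv ℝ u) :=
    (hu.fderiv_right (m := 1) (by norm_num)).differentiable (by norm_num)
  have hline : ∀ w a, HasDerivAt (fun t : ℝ => fderiv ℝ u (x + t • w) a)
      (fderiv ℝ (fderiv ℝ u) x w a) 0 := by
    intro w a
    have h1 : HasDerivAt (fun t : ℝ => x + t • w) w 0 := by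
      simpa using ((hasDerivAt_id (0 : ℝ)).smul_const w).const_add x
    have h2 : HasFDerivAt (fderiv ℝ u) (fderiv ℝ (fderiv ℝ u) x) (x + (0 : ℝ) • w) := by
      simpa using (hd x).hasFDerivAt
    have h3 := h2.comp_hasDerivAt (0 : ℝ) h1
    have h4 := h3.clm_apply (hasDerivAt_const (0 : ℝ) a)
    simpa using h4
  have hsymm : ∀ a b, fderiv ℝ (fderiv ℝ u) x a b = fderiv ℝ (fderiv ℝ u) x b a := fun a b =>
    (hu.contDiffAt.isSymmSndFDerivAt (by simp)) a b
  have hxe : fderiv ℝ u x e = k • n := by rw [hx, real_inner_self_eq_norm_sq, he]; simp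
  have hxv : fderiv ℝ u x v = 0 := by rw [hx, hev]; simp
  -- The squared norm `‖du e‖² + ‖du v‖²` is the constant `k²`; its derivative in the direction `v`
  -- is `2k ⟪n, D²u(v, e)⟫`, as `du v = 0` at `x`.
  have hnorm : ⟪n, fderiv ℝ (fderiv ℝ u) x v e⟫ = 0 := by
    have h1 := ((hline v e).inner ℝ (hline v e)).add ((hline v v).inner ℝ (hline v v))
    have h2 : (fun t : ℝ => ⟪fderiv ℝ u (x + t • v) e, fderiv ℝ u (x + t • v) e⟫ +
        ⟪fderiv ℝ u (x + t • v) v, fderiv ℝ u (x + t • v) v⟫) = fun _ => k ^ 2 := by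
      funext t
      obtain ⟨e', n', he', hn', h⟩ := hA (x + t • v)
      have := inner_mul_inner_add hP he hv hev e' e'
      rw [real_inner_self_eq_norm_sq e', he', real_inner_comm e' e, real_inner_comm e' v] at this
      simp only [h, real_inner_self_eq_norm_sq, norm_smul, hn', Real.norm_eq_abs, mul_one, sq_abs]
      linear_combination k ^ 2 * this
    have h3 := h1.congr_of_eventuallyEq (f₁ := fun _ => k ^ 2) (Filter.Eventually.of_forall
      fun t => (congrFun h2 t).symm)
    have h4 := h3.unique (hasDerivAt_const (0 : ℝ) (k ^ 2))
    simp only [zero_smul, add_zero, hxe, hxv, inner_zero_left, inner_zero_right,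
      real_inner_smul_left, real_inner_smul_right] at h4
    rw [real_inner_comm n] at h4
    have : 2 * k * ⟪n, fderiv ℝ (fderiv ℝ u) x v e⟫ = 0 := by linarith
    simpa [hk] using this
  set b := fderiv ℝ (fderiv ℝ u) x e v with hb
  have hbn : ⟪n, b⟫ = 0 := by rw [hb, hsymm, hnorm]
  -- The minor of `du` formed with `e, v` and the test vectors `n, b` vanishes identically by rank
  -- one. Its derivative along `e` at `x` is `k‖b‖²`, because `du v = 0` and `⟪n, b⟫ = 0` there.
  have h1 := (((hline e e).inner ℝ (hasDerivAt_const 0 n)).mul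
    ((hline e v).inner ℝ (hasDerivAt_const 0 b))).sub
    (((hline e e).inner ℝ (hasDerivAt_const 0 b)).mul
    ((hline e v).inner ℝ (hasDerivAt_const 0 n)))
  have h3 := h1.congr_of_eventuallyEq (f₁ := fun _ => 0) (Filter.Eventually.of_forall fun t => by
      obtain ⟨e', n', he', hn', h⟩ := hA (x + t • e)
      simp only [Pi.sub_apply, Pi.mul_apply, h, real_inner_smul_left]
      ring)
  have h4 := h3.unique (hasDerivAt_const (0 : ℝ) (0 : ℝ))
  simp only [zero_smul, add_zero, hxe, hxv, inner_zero_left, inner_zero_right,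
    real_inner_smul_left, ← hb, real_inner_self_eq_norm_sq, hn, hbn] at h4
  have : k * ‖b‖ ^ 2 = 0 := by linarith
  simpa [hk] using this

/-- A kernel direction of the differential persists along the orthogonal line. -/
theorem fderiv_apply_eq_zero_along_line (hP : Module.finrank ℝ P = 2) {u : P → N}
    (hu : ContDiff ℝ 2 u) {k : ℝ} (hk : 0 < k)
    (hA : ∀ y, ∃ e n, ‖e‖ = 1 ∧ ‖n‖ = 1 ∧ ∀ a, fderiv ℝ u y a = (k * ⟪e, a⟫) • n)
    {x e₀ v₀ : P} (he₀ : ‖e₀‖ = 1) (hev₀ : ⟪e₀, v₀⟫ = 0)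
    (hx : fderiv ℝ u x v₀ = 0) (T : ℝ) : fderiv ℝ u (x + T • e₀) v₀ = 0 := by
  wlog hT : 0 ≤ T generalizing T e₀
  · have := this (e₀ := -e₀) (by simpa) (by simpa using hev₀) (-T) (by linarith)
    simpa using this
  have hd : Differentiable ℝ (fderiv ℝ u) :=
    (hu.fderiv_right (m := 1) (by norm_num)).differentiable (by norm_num)
  have hc : Continuous (fderiv ℝ (fderiv ℝ u)) :=
    (hu.fderiv_right (m := 1) (by norm_num)).continuous_fderiv (by norm_num)
  have hderiv : ∀ t : ℝ, HasDerivAt (fun t : ℝ => fderiv ℝ u (x + t • e₀) v₀)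
      (fderiv ℝ (fderiv ℝ u) (x + t • e₀) e₀ v₀) t := by
    intro t
    have h1 : HasDerivAt (fun t : ℝ => x + t • e₀) e₀ t := by
      simpa using ((hasDerivAt_id t).smul_const e₀).const_add x
    exact (((hd _).hasFDerivAt.comp_hasDerivAt t h1).clm_apply
      (hasDerivAt_const t v₀)).congr_deriv (by simp)
  obtain ⟨K, hK⟩ := (isCompact_Icc (a := (0 : ℝ)) (b := T)).exists_bound_of_continuousOn
    (f := fun t : ℝ => fderiv ℝ (fderiv ℝ u) (x + t • e₀))
    (hc.comp (by fun_prop)).continuousOn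
  -- Grönwall's argument: `t ↦ du(x + t e₀) v₀` vanishes at `0` and its derivative is at most `2K /
  -- k` times its own norm, where `K` bounds the second derivative on the segment. No smooth choice
  -- of the kernel direction is needed.
  refine eq_zero_of_abs_deriv_le_mul_abs_self_of_eq_zero_right (K := 2 * K / k)
    (f := fun t : ℝ => fderiv ℝ u (x + t • e₀) v₀)
    (f' := fun t : ℝ => fderiv ℝ (fderiv ℝ u) (x + t • e₀) e₀ v₀) (a := 0) (b := T)
    (fun t _ => (hderiv t).continuousAt.continuousWithinAt)
    (fun t _ => (hderiv t).hasDerivWithinAt) (by simpa using hx) ?_ T ⟨hT, le_rfl⟩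
  intro t ht
  have hB := hK t ⟨ht.1, ht.2.le⟩
  set y := x + t • e₀
  obtain ⟨e, n, he, hn, hy⟩ := hA y
  obtain ⟨v, hv, hev⟩ := exists_unit_inner_eq_zero hP e
  set B := fderiv ℝ (fderiv ℝ u) y
  have hBev : B e v = 0 := fderiv_fderiv_eq_zero_of_rankOne hP hu hk.ne' hA he hv hev hn hy
  have h1 : B e₀ v = ⟪v, e₀⟫ • B v v := by
    conv_lhs => rw [eq_inner_smul_add_inner_smul hP he hv hev e₀]
    simp [hBev]
  -- Since `B e v = 0` and `e₀ ⟂ v₀`, the factor `⟪e, v₀⟫` splits off from `B e₀ v₀`; and `k |⟪e,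
  -- v₀⟫|` is exactly the norm of `du v₀`.
  have h2 : B e₀ v₀ = ⟪e, v₀⟫ • (B e₀ e - ⟪e, e₀⟫ • B v v) := by
    conv_lhs => rw [eq_inner_smul_add_inner_smul hP he hv hev v₀]
    have h3 := inner_mul_inner_add hP he hv hev e₀ v₀
    rw [hev₀] at h3
    rw [map_add, map_smul, map_smul, h1, smul_sub, smul_smul, smul_smul,
      show ⟪v, v₀⟫ * ⟪v, e₀⟫ = -(⟪e, v₀⟫ * ⟪e, e₀⟫) by linarith, neg_smul, sub_eq_add_neg]
  have hnb : ∀ a b : P, ‖a‖ = 1 → ‖b‖ = 1 → ‖B a b‖ ≤ K := fun a b ha hb => by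
    have := B.le_opNorm₂ a b
    rw [ha, hb] at this
    linarith
  have h4 : |⟪e, e₀⟫| ≤ 1 := by simpa [he, he₀] using abs_real_inner_le_norm e e₀
  have h5 : ‖B e₀ e - ⟪e, e₀⟫ • B v v‖ ≤ 2 * K := by
    refine (norm_sub_le _ _).trans ?_
    rw [norm_smul, Real.norm_eq_abs]
    have := hnb v v hv hv
    have := hnb e₀ e he₀ he
    nlinarith [norm_nonneg (B v v)]
  rw [h2, hy, norm_smul, norm_smul, hn, Real.norm_eq_abs, Real.norm_eq_abs, abs_mul,
    abs_of_pos hk]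
  calc |⟪e, v₀⟫| * ‖B e₀ e - ⟪e, e₀⟫ • B v v‖ ≤ |⟪e, v₀⟫| * (2 * K) := by gcongr
    _ = 2 * K / k * (k * |⟪e, v₀⟫| * 1) := by field_simp

/-- If the differential of a map of the plane has rank one and constant norm, then its kernel is
constant. -/
theorem fderiv_apply_eq_zero_of_rankOne (hP : Module.finrank ℝ P = 2) {u : P → N}
    (hu : ContDiff ℝ 2 u) {k : ℝ} (hk : 0 < k)
    (hA : ∀ y, ∃ e n, ‖e‖ = 1 ∧ ‖n‖ = 1 ∧ ∀ a, fderiv ℝ u y a = (k * ⟪e, a⟫) • n)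
    {x a : P} (ha : fderiv ℝ u x a = 0) (y : P) : fderiv ℝ u y a = 0 := by
  have hker : ∀ {e : P} {n : N} {z : P}, ‖n‖ = 1 → (∀ a, fderiv ℝ u z a = (k * ⟪e, a⟫) • n) →
      ∀ b, fderiv ℝ u z b = 0 → ⟪e, b⟫ = 0 := by
    intro e n z hn hz b hb
    have hn0 : n ≠ 0 := fun h => by simp [h] at hn
    rw [hz] at hb
    simpa [hn0, hk.ne'] using hb
  obtain ⟨ex, nx, hex, hnx, hx⟩ := hA x
  obtain ⟨ey, ny, hey, hny, hy⟩ := hA y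
  obtain ⟨vx, hvx, hevx⟩ := exists_unit_inner_eq_zero hP ex
  obtain ⟨vy, hvy, hevy⟩ := exists_unit_inner_eq_zero hP ey
  have hxv : fderiv ℝ u x vx = 0 := by rw [hx, hevx]; simp
  have hyv : fderiv ℝ u y vy = 0 := by rw [hy, hevy]; simp
  suffices h : ⟪ey, vx⟫ = 0 by
    rw [eq_inner_smul_add_inner_smul hP hex hvx hevx a, hker hnx hx a ha, hy]
    simp [inner_smul_right, h]
  -- If the kernels differ, the line through `x` in direction `ex` meets the line through `y` in
  -- direction `ey`. At the common point both `vx` and `vy` are in the kernel, so its unit conormal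
  -- `e` would be zero.
  by_contra h
  have h' : ⟪vx, ey⟫ ≠ 0 := by rwa [real_inner_comm]
  obtain ⟨s, hs⟩ : ∃ s : ℝ, ⟪vx, y + s • ey - x⟫ = 0 := by
    refine ⟨⟪vx, x - y⟫ / ⟪vx, ey⟫, ?_⟩
    rw [inner_sub_right, inner_add_right, inner_smul_right, inner_sub_right]
    field_simp
    ring
  have hz : y + s • ey = x + ⟪ex, y + s • ey - x⟫ • ex := by
    have := eq_inner_smul_add_inner_smul hP hex hvx hevx (y + s • ey - x)
    rw [hs, zero_smul, add_zero] at this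
    rw [← this]
    abel
  have h1 := fderiv_apply_eq_zero_along_line hP hu hk hA hey hevy hyv s
  have h2 := fderiv_apply_eq_zero_along_line hP hu hk hA hex hevx hxv ⟪ex, y + s • ey - x⟫
  rw [← hz] at h2
  obtain ⟨e, n, he, hn, hzz⟩ := hA (y + s • ey)
  have h3 := hker hn hzz _ h1
  have h4 := hker hn hzz _ h2
  have h5 := inner_mul_inner_add hP hey hvy hevy e vx
  rw [h4, real_inner_comm e vy, h3] at h5
  have h6 : ⟪ey, e⟫ = 0 := by
    have : ⟪ey, e⟫ * ⟪ey, vx⟫ = 0 := by linarith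
    exact (mul_eq_zero.mp this).resolve_right h
  have h7 := eq_inner_smul_add_inner_smul hP hey hvy hevy e
  rw [h6, real_inner_comm, h3] at h7
  simp [h7] at he

end RankOne

end
noncomputable section

/-! ### Product coordinates for an immersion whose tangent planes split -/

section ProductChart

open Metric Set

/-- The inverse function theorem, with an inverse defined on a ball. -/
theorem exists_openPartialHomeomorph_of_injective {E F : Type*} [NormedAddCommGroup E]
    [NormedSpace ℝ E] [NormedAddCommGroup F] [NormedSpace ℝ F] [FiniteDimensional ℝ E]
    [FiniteDimensional ℝ F] (hEF : Module.finrank ℝ E = Module.finrank ℝ F) {h : E → F}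
    {Ω : Set E} (hΩ : IsOpen Ω) (hh : ContDiffOn ℝ ∞ h Ω) {x₀ : E} (hx₀ : x₀ ∈ Ω)
    (hinj : Function.Injective (fderiv ℝ h x₀)) :
    ∃ e : OpenPartialHomeomorph E F, x₀ ∈ e.source ∧ e.source ⊆ Ω ∧ (e : E → F) = h ∧
      ContDiffOn ℝ ∞ e.symm e.target ∧ ∃ r > 0, e.target = ball (h x₀) r := by
  have : CompleteSpace E := FiniteDimensional.complete ℝ E
  let A : E ≃L[ℝ] F := (LinearEquiv.ofInjectiveOfFinrankEq _ hinj hEF).toContinuousLinearEquiv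
  have hA : (A : E →L[ℝ] F) = fderiv ℝ h x₀ := by ext; rfl
  have hat : ContDiffAt ℝ ∞ h x₀ := hh.contDiffAt (hΩ.mem_nhds hx₀)
  have hd : HasFDerivAt h (A : E →L[ℝ] F) x₀ := by
    rw [hA]; exact (hat.differentiableAt (by simp)).hasFDerivAt
  let e₁ := hat.toOpenPartialHomeomorph h hd (by simp)
  have he₁ : (e₁ : E → F) = h := hat.toOpenPartialHomeomorph_coe hd (by simp)
  -- Restricting to the open set where the differential is invertible makes the inverse smooth on
  -- its whole domain, not only at `h x₀`.
  let S : Set E := Ω ∩ fderiv ℝ h ⁻¹' range ((↑) : (E ≃L[ℝ] F) → E →L[ℝ] F)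
  have hS : IsOpen S := (hh.continuousOn_fderiv_of_isOpen hΩ (by simp)).isOpen_inter_preimage hΩ
    ContinuousLinearEquiv.isOpen
  let e₂ := e₁.restrOpen S hS
  have hx₂ : x₀ ∈ e₂.source := ⟨hat.mem_toOpenPartialHomeomorph_source hd (by simp), hx₀, A, hA⟩
  have he₂ : (e₂ : E → F) = h := he₁
  obtain ⟨r, hr, hball⟩ := Metric.isOpen_iff.mp e₂.open_target _ (e₂.map_source hx₂)
  rw [he₂] at hball
  let e := (e₂.symm.restrOpen (ball (h x₀) r) isOpen_ball).symm
  have htarget : e.target = ball (h x₀) r := inter_eq_right.mpr hball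
  have hcoe : (e : E → F) = h := he₂
  have hxe : x₀ ∈ e.source := by
    have : h x₀ ∈ e.target := by rw [htarget]; exact mem_ball_self hr
    have h1 := e.map_target this
    have h2 : e.symm (h x₀) = x₀ := by
      have := e₂.left_inv hx₂
      rwa [he₂] at this
    rwa [h2] at h1
  have hsub : e.source ⊆ S := by
    intro x hx
    have h1 := e.map_source hx
    rw [← e.left_inv hx]
    have : e₂.symm (e x) ∈ e₂.source := e₂.map_target h1.1
    exact this.2
  refine ⟨e, hxe, fun x hx => (hsub hx).1, hcoe, ?_, r, hr, htarget⟩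
  intro z hz
  have h1 := hsub (e.map_target hz)
  obtain ⟨hΩz, B, hB⟩ := h1
  have h2 : ContDiffAt ℝ ∞ h (e.symm z) := hh.contDiffAt (hΩ.mem_nhds hΩz)
  refine (e.contDiffAt_symm (f₀' := B) hz ?_ (by rw [hcoe]; exact h2)).contDiffWithinAt
  rw [hB, hcoe]
  exact (h2.differentiableAt (by simp)).hasFDerivAt

variable {E N : Type*} [NormedAddCommGroup E] [NormedSpace ℝ E]
  [NormedAddCommGroup N] [InnerProductSpace ℝ N]

theorem Submodule.eq_inner_smul_add_inner_smul {N : Type*} [NormedAddCommGroup N]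
    [InnerProductSpace ℝ N] {T : Submodule ℝ N} (hT : Module.finrank ℝ T = 2)
    {e v : N} (heT : e ∈ T) (hvT : v ∈ T) (he : ‖e‖ = 1) (hv : ‖v‖ = 1) (hev : ⟪e, v⟫ = 0) {a : N}
    (ha : a ∈ T) : a = ⟪e, a⟫ • e + ⟪v, a⟫ • v := by
  simpa using congrArg Subtype.val (_root_.eq_inner_smul_add_inner_smul hT (e := ⟨e, heT⟩)
    (v := ⟨v, hvT⟩) (by simpa) (by simpa) (by simpa) ⟨a, ha⟩)

/-- The pull-back of `⟪W, ·⟫` under `F` has a primitive if `dW` is normal to `F`. -/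
theorem exists_primitive_inner {F W : E → N} {x₀ : E} {r : ℝ}
    (hF : ContDiffOn ℝ ∞ F (ball x₀ r)) (hW : ContDiffOn ℝ ∞ W (ball x₀ r))
    (h : ∀ x ∈ ball x₀ r, ∀ u v, ⟪fderiv ℝ W x u, fderiv ℝ F x v⟫ = 0) :
    ∃ σ : E → ℝ, ContDiffOn ℝ ∞ σ (ball x₀ r) ∧
      ∀ x ∈ ball x₀ r, ∀ v, fderiv ℝ σ x v = ⟪W x, fderiv ℝ F x v⟫ := by
  have hdF : ContDiffOn ℝ ∞ (fderiv ℝ F) (ball x₀ r) :=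
    hF.fderiv_of_isOpen isOpen_ball (by simp)
  let η : E → E →L[ℝ] ℝ := fun x => (innerSL ℝ (W x)).comp (fderiv ℝ F x)
  have hη : ContDiffOn ℝ ∞ η (ball x₀ r) :=
    ((innerSL ℝ).contDiff.comp_contDiffOn hW).clm_comp hdF
  obtain ⟨σ, hσ⟩ := (convex_ball x₀ r).exists_forall_hasFDerivAt_of_fderiv_symmetric isOpen_ball
    (hη.differentiableOn (by simp)) (by
      intro x hx u v
      have hx' := isOpen_ball.mem_nhds hx
      have h1 : DifferentiableAt ℝ W x := (hW.contDiffAt hx').differentiableAt (by simp)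
      have h2 : DifferentiableAt ℝ (fderiv ℝ F) x := (hdF.contDiffAt hx').differentiableAt (by simp)
      -- The term `⟪dW u, dF v⟫` of the product rule vanishes by hypothesis; what remains is
      -- symmetric, so `η` is closed and has a primitive on the ball.
      have key : ∀ u v, fderiv ℝ η x u v = ⟪W x, fderiv ℝ (fderiv ℝ F) x u v⟫ := by
        intro u v
        have h3 : HasFDerivAt (fun z => η z v) ((fderiv ℝ η x).flip v) x := by
          have := ((hη.contDiffAt hx').differentiableAt (by simp)).hasFDerivAt.clm_apply
            (hasFDerivAt_const v x)
          simpa using this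
        have h4 : HasFDerivAt (fun z => fderiv ℝ F z v) ((fderiv ℝ (fderiv ℝ F) x).flip v) x := by
          have := h2.hasFDerivAt.clm_apply (hasFDerivAt_const v x)
          simpa using this
        have h5 := h1.hasFDerivAt.inner ℝ h4
        have h6 := congrArg (fun L => L u) (h3.unique h5)
        simpa [fderivInnerCLM_apply, h x hx] using h6
      rw [key, key, ((hF.contDiffAt hx').isSymmSndFDerivAt
        (by simp only [minSmoothness_of_isRCLikeNormedField]; exact ENat.LEInfty.out)) u v])
  refine ⟨σ, ?_, fun x hx v => by rw [(hσ x hx).fderiv]; rfl⟩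
  rw [contDiffOn_infty_iff_fderiv_of_isOpen isOpen_ball]
  exact ⟨fun x hx => (hσ x hx).differentiableAt.differentiableWithinAt,
    hη.congr fun x hx => (hσ x hx).fderiv⟩

/-- A smooth unit field in the intersection of the tangent planes of `F` with a fixed subspace,
if the tangent planes split orthogonally; its derivative is normal to `F`. -/
theorem exists_unit_tangent_field [FiniteDimensional ℝ N] (hE : Module.finrank ℝ E = 2)
    {F : E → N} {Ω : Set E}
    (hΩ : IsOpen Ω) (hF : ContDiffOn ℝ ∞ F Ω)
    (hinj : ∀ x ∈ Ω, Function.Injective (fderiv ℝ F x)) {V V' : Submodule ℝ N} (hVV' : V' ≤ Vᗮ)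
    (hV : ∀ x ∈ Ω, ∃ y, fderiv ℝ F x y ∈ V ∧ ‖fderiv ℝ F x y‖ = 1)
    (hV' : ∀ x ∈ Ω, ∃ y, fderiv ℝ F x y ∈ V' ∧ ‖fderiv ℝ F x y‖ = 1)
    {x₀ : E} (hx₀ : x₀ ∈ Ω) :
    ∃ U ⊆ Ω, IsOpen U ∧ x₀ ∈ U ∧ ∃ W : E → N, ContDiffOn ℝ ∞ W U ∧ ∀ x ∈ U, W x ∈ V ∧
      ‖W x‖ = 1 ∧ W x ∈ (fderiv ℝ F x).toLinearMap.range ∧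
      ∀ u v, ⟪fderiv ℝ W x u, fderiv ℝ F x v⟫ = 0 := by
  obtain ⟨y₀, hy₀V, hy₀⟩ := hV x₀ hx₀
  have hdF : ContDiffOn ℝ ∞ (fderiv ℝ F) Ω := hF.fderiv_of_isOpen hΩ (by simp)
  -- The vector `dF y₀` lies in `V` only at `x₀`; projecting it to `V` gives a smooth field which is
  -- nonzero nearby and, by the orthogonal splitting, still tangent.
  let n : E → N := fun x => V.starProjection (fderiv ℝ F x y₀)
  have hn : ContDiffOn ℝ ∞ n Ω := V.starProjection.contDiff.comp_contDiffOn
    (hdF.clm_apply contDiffOn_const)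
  let U : Set E := Ω ∩ n ⁻¹' {0}ᶜ
  have hU : IsOpen U := hn.continuousOn.isOpen_inter_preimage hΩ isOpen_compl_singleton
  have hnx₀ : n x₀ = fderiv ℝ F x₀ y₀ := V.starProjection_eq_self_iff.mpr hy₀V
  have hx₀U : x₀ ∈ U := by
    refine ⟨hx₀, fun h => ?_⟩
    rw [mem_singleton_iff, hnx₀] at h
    simp [h] at hy₀
  let W : E → N := fun x => ‖n x‖⁻¹ • n x
  have hW : ContDiffOn ℝ ∞ W U := ((hn.mono inter_subset_left).norm ℝ fun x hx => hx.2).inv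
    (fun x hx => norm_ne_zero_iff.mpr hx.2) |>.smul (hn.mono inter_subset_left)
  have hWV : ∀ x, W x ∈ V := fun x => V.smul_mem _ (V.starProjection_apply_mem _)
  have hW1 : ∀ x ∈ U, ‖W x‖ = 1 := fun x hx => by
    rw [norm_smul, norm_inv, norm_norm, inv_mul_cancel₀ (norm_ne_zero_iff.mpr hx.2)]
  refine ⟨U, inter_subset_left, hU, hx₀U, W, hW, fun x hx => ?_⟩
  obtain ⟨y₁, hy₁V, hy₁⟩ := hV x hx.1
  obtain ⟨y₂, hy₂V, hy₂⟩ := hV' x hx.1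
  have hfin : Module.finrank ℝ (fderiv ℝ F x).toLinearMap.range = 2 := by
    rw [LinearMap.finrank_range_of_inj (hinj x hx.1), hE]
  have hortho : ⟪fderiv ℝ F x y₁, fderiv ℝ F x y₂⟫ = 0 := hVV' hy₂V _ hy₁V
  have hexp : ∀ v, fderiv ℝ F x v = ⟪fderiv ℝ F x y₁, fderiv ℝ F x v⟫ • fderiv ℝ F x y₁ +
      ⟪fderiv ℝ F x y₂, fderiv ℝ F x v⟫ • fderiv ℝ F x y₂ := fun v =>
    Submodule.eq_inner_smul_add_inner_smul hfin ⟨y₁, rfl⟩ ⟨y₂, rfl⟩ hy₁ hy₂ hortho ⟨v, rfl⟩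
  obtain ⟨c, hc⟩ : ∃ c : ℝ, W x = c • fderiv ℝ F x y₁ := by
    refine ⟨‖n x‖⁻¹ * ⟪fderiv ℝ F x y₁, fderiv ℝ F x y₀⟫, ?_⟩
    have h1 : n x = ⟪fderiv ℝ F x y₁, fderiv ℝ F x y₀⟫ • fderiv ℝ F x y₁ := by
      change V.starProjection (fderiv ℝ F x y₀) = _
      conv_lhs => rw [hexp y₀]
      rw [map_add, map_smul, map_smul, V.starProjection_eq_self_iff.mpr hy₁V,
        V.starProjection_apply_eq_zero_iff.mpr (hVV' hy₂V), smul_zero, add_zero]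
    change ‖n x‖⁻¹ • n x = _
    rw [mul_smul, ← h1]
  refine ⟨hWV x, hW1 x hx, ⟨c • y₁, by rw [hc]; exact map_smul _ _ _⟩, fun u v => ?_⟩
  have hWx : HasFDerivAt W (fderiv ℝ W x) x :=
    ((hW.contDiffAt (hU.mem_nhds hx)).differentiableAt (by simp)).hasFDerivAt
  have hd1 : ⟪W x, fderiv ℝ W x u⟫ = 0 := by
    have h1 := (hWx.inner ℝ hWx).congr_of_eventuallyEq (f₁ := fun _ => 1) (by
      filter_upwards [hU.mem_nhds hx] with z hz
      rw [real_inner_self_eq_norm_sq, hW1 z hz, one_pow])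
    have h2 := congrArg (fun L => L u) (h1.unique (hasFDerivAt_const (1 : ℝ) x))
    simp only [ContinuousLinearMap.comp_apply, ContinuousLinearMap.prod_apply,
      fderivInnerCLM_apply, zero_apply] at h2
    rw [real_inner_comm (W x)] at h2
    linarith
  have hd2 : ⟪fderiv ℝ W x u, fderiv ℝ F x y₂⟫ = 0 := by
    have h1 := (hWx.inner ℝ (hasFDerivAt_const (fderiv ℝ F x y₂) x)).congr_of_eventuallyEq
      (f₁ := fun _ => 0) (Filter.Eventually.of_forall fun z => (hVV' hy₂V _ (hWV z)).symm)
    have h2 := congrArg (fun L => L u) (h1.unique (hasFDerivAt_const (0 : ℝ) x))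
    simpa [fderivInnerCLM_apply] using h2
  have hc0 : c ≠ 0 := fun h => by
    have := hW1 x hx
    simp [hc, h] at this
  have hd3 : ⟪fderiv ℝ W x u, fderiv ℝ F x y₁⟫ = 0 := by
    rw [hc, real_inner_smul_left, real_inner_comm] at hd1
    exact (mul_eq_zero.mp hd1).resolve_left hc0
  rw [hexp v, inner_add_right, inner_smul_right, inner_smul_right, hd2, hd3]
  simp

/-- The differential of a map from the plane is a product of two isometries into `V` and `Vᗮ`. -/
def IsSplitDeriv (V : Submodule ℝ N) (A : ℝ × ℝ →L[ℝ] N) : Prop :=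
  A (1, 0) ∈ V ∧ ‖A (1, 0)‖ = 1 ∧ A (0, 1) ∈ Vᗮ ∧ ‖A (0, 1)‖ = 1

/-- An immersion whose tangent planes split along `V` and `Vᗮ` has arc length coordinates. -/
theorem exists_flat_product_chart [FiniteDimensional ℝ E] [FiniteDimensional ℝ N]
    (hE : Module.finrank ℝ E = 2) {F : E → N} {Ω : Set E}
    (hΩ : IsOpen Ω) (hF : ContDiffOn ℝ ∞ F Ω)
    (hinj : ∀ x ∈ Ω, Function.Injective (fderiv ℝ F x)) {V : Submodule ℝ N}
    (hV : ∀ x ∈ Ω, ∃ y, fderiv ℝ F x y ∈ V ∧ ‖fderiv ℝ F x y‖ = 1)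
    (hV' : ∀ x ∈ Ω, ∃ y, fderiv ℝ F x y ∈ Vᗮ ∧ ‖fderiv ℝ F x y‖ = 1)
    {x₀ : E} (hx₀ : x₀ ∈ Ω) :
    ∃ e : OpenPartialHomeomorph E (ℝ × ℝ), x₀ ∈ e.source ∧ e.source ⊆ Ω ∧ e x₀ = 0 ∧
      ContDiffOn ℝ ∞ e e.source ∧ ContDiffOn ℝ ∞ e.symm e.target ∧
      (∃ r > 0, e.target = ball 0 r) ∧
      ∀ z ∈ e.target, IsSplitDeriv V (fderiv ℝ (F ∘ e.symm) z) := by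
  obtain ⟨U₁, hU₁Ω, hU₁, hx₁, W₁, hW₁, h₁⟩ :=
    exists_unit_tangent_field hE hΩ hF hinj le_rfl hV hV' hx₀
  obtain ⟨U₂, hU₂Ω, hU₂, hx₂, W₂, hW₂, h₂⟩ :=
    exists_unit_tangent_field hE hΩ hF hinj V.le_orthogonal_orthogonal hV' hV hx₀
  obtain ⟨ρ, hρ, hball⟩ := Metric.isOpen_iff.mp (hU₁.inter hU₂) x₀ ⟨hx₁, hx₂⟩
  have hB₁ : ball x₀ ρ ⊆ U₁ := fun x hx => (hball hx).1
  have hB₂ : ball x₀ ρ ⊆ U₂ := fun x hx => (hball hx).2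
  have hBΩ : ball x₀ ρ ⊆ Ω := hB₁.trans hU₁Ω
  obtain ⟨σ, hσ, hσd⟩ := exists_primitive_inner (hF.mono hBΩ) (hW₁.mono hB₁)
    fun x hx => (h₁ x (hB₁ hx)).2.2.2
  obtain ⟨τ, hτ, hτd⟩ := exists_primitive_inner (hF.mono hBΩ) (hW₂.mono hB₂)
    fun x hx => (h₂ x (hB₂ hx)).2.2.2
  -- The differential of `D` reads off the coefficients of `dF` in the orthonormal basis `W₁, W₂`,
  -- so in these coordinates the partial derivatives of `F` are `W₁` and `W₂`.
  let D : E → ℝ × ℝ := fun x => (σ x - σ x₀, τ x - τ x₀)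
  have hD : ContDiffOn ℝ ∞ D (ball x₀ ρ) :=
    (hσ.sub contDiffOn_const).prodMk (hτ.sub contDiffOn_const)
  have hDd : ∀ x ∈ ball x₀ ρ, ∀ v, fderiv ℝ D x v =
      (⟪W₁ x, fderiv ℝ F x v⟫, ⟪W₂ x, fderiv ℝ F x v⟫) := by
    intro x hx v
    have hx' := isOpen_ball.mem_nhds hx
    have h3 := ((hσ.contDiffAt hx').differentiableAt (by simp)).hasFDerivAt.sub_const (σ x₀)
    have h4 := ((hτ.contDiffAt hx').differentiableAt (by simp)).hasFDerivAt.sub_const (τ x₀)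
    rw [(h3.prodMk h4).fderiv, ContinuousLinearMap.prod_apply, hσd x hx, hτd x hx]
  have hexp : ∀ x ∈ ball x₀ ρ, ∀ v, fderiv ℝ F x v =
      ⟪W₁ x, fderiv ℝ F x v⟫ • W₁ x + ⟪W₂ x, fderiv ℝ F x v⟫ • W₂ x := by
    intro x hx v
    obtain ⟨a1, a2, a3, -⟩ := h₁ x (hB₁ hx)
    obtain ⟨b1, b2, b3, -⟩ := h₂ x (hB₂ hx)
    refine Submodule.eq_inner_smul_add_inner_smul ?_ a3 b3 a2 b2 (b1 _ a1) ⟨v, rfl⟩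
    rw [LinearMap.finrank_range_of_inj (hinj x (hBΩ hx)), hE]
  have hx₀B := mem_ball_self (x := x₀) hρ
  obtain ⟨e, hxe, heB, hcoe, hsymm, r, hr, htarget⟩ := exists_openPartialHomeomorph_of_injective
    (by simp [hE]) isOpen_ball hD hx₀B (by
      rw [injective_iff_map_eq_zero]
      intro v hv
      rw [hDd x₀ hx₀B v, Prod.mk_eq_zero] at hv
      have := hexp x₀ hx₀B v
      rw [hv.1, hv.2, zero_smul, zero_smul, add_zero] at this
      exact hinj x₀ hx₀ (by rw [this, map_zero]))
  have hDx₀ : D x₀ = 0 := by simp [D]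
  refine ⟨e, hxe, heB.trans hBΩ, by rw [hcoe, hDx₀], by rw [hcoe]; exact hD.mono heB, hsymm,
    ⟨r, hr, by rw [htarget, hDx₀]⟩, fun z hz => ?_⟩
  have hxB := heB (e.map_target hz)
  set x := e.symm z with hx
  have hez : HasFDerivAt e.symm (fderiv ℝ e.symm z) z :=
    ((hsymm.contDiffAt (e.open_target.mem_nhds hz)).differentiableAt (by simp)).hasFDerivAt
  have hFx : HasFDerivAt F (fderiv ℝ F x) x :=
    ((hF.contDiffAt (hΩ.mem_nhds (hBΩ hxB))).differentiableAt (by simp)).hasFDerivAt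
  have hDx : HasFDerivAt D (fderiv ℝ D x) x :=
    ((hD.contDiffAt (isOpen_ball.mem_nhds hxB)).differentiableAt (by simp)).hasFDerivAt
  have hinv : ∀ w, fderiv ℝ D x (fderiv ℝ e.symm z w) = w := by
    intro w
    have h4 : HasFDerivAt (D ∘ e.symm) _ z := hDx.comp z hez
    have h5 := h4.congr_of_eventuallyEq (f₁ := id) (by
      filter_upwards [e.open_target.mem_nhds hz] with y hy
      rw [Function.comp_apply, ← hcoe, e.right_inv hy, id])
    exact congrArg (fun L => L w) (h5.unique (hasFDerivAt_id z))
  have hval : ∀ w : ℝ × ℝ, fderiv ℝ (F ∘ e.symm) z w = w.1 • W₁ x + w.2 • W₂ x := by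
    intro w
    have h6 : HasFDerivAt (F ∘ e.symm) _ z := hFx.comp z hez
    rw [h6.fderiv, ContinuousLinearMap.comp_apply, hexp x hxB]
    have := hinv w
    rw [hDd x hxB] at this
    conv_rhs => rw [← this]
  obtain ⟨a1, a2, -⟩ := h₁ x (hB₁ hxB)
  obtain ⟨b1, b2, -⟩ := h₂ x (hB₂ hxB)
  refine ⟨?_, ?_, ?_, ?_⟩ <;> rw [hval] <;> simpa

end ProductChart

end
noncomputable section

/-! ### Tangent planes, charts and completeness of an immersed surface -/

section SurfaceBasics

open Metric Set

variable {M : Type*} [TopologicalSpace M] [ChartedSpace (EuclideanSpace ℝ (Fin 2)) M]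
  {f : M → E4}

/-- The normal form of an immersion provides a differentiable local left inverse `ρ` of `f`, by
projecting to the first factor; the chain rule then gives a left inverse of the differential. -/
theorem surfDiff_injective [IsManifold (𝓡 2) ∞ M]
    (hf : Manifold.IsImmersion (𝓡 2) 𝓘(ℝ, E4) ∞ f) (p : M) :
    Function.Injective (surfDiff f p) := by
  have h := hf.isImmersionAt p
  let L : EuclideanSpace ℝ (Fin 2) × h.complement →L[ℝ] EuclideanSpace ℝ (Fin 2) :=
    ContinuousLinearMap.fst ℝ _ _
  let ρ : E4 → M := h.domChart.symm ∘ (L ∘ h.equiv.symm) ∘ h.codChart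
  have hρf : ∀ q ∈ h.domChart.source, ρ (f q) = q := by
    intro q hq
    have h1 : h.domChart q ∈ (h.domChart.extend (𝓡 2)).target := by
      simpa using h.domChart.map_source hq
    have h2 := h.writtenInCharts h1
    simp only [Function.comp_apply, OpenPartialHomeomorph.extend_coe,
      OpenPartialHomeomorph.extend_coe_symm, modelWithCornersSelf_coe,
      modelWithCornersSelf_coe_symm, id, h.domChart.left_inv hq] at h2
    simp [ρ, L, h2, h.domChart.left_inv hq]
  have hval : (L ∘ h.equiv.symm) (h.codChart (f p)) = h.domChart p := by
    have h3 := congrArg h.domChart (hρf p h.mem_domChart_source)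
    have h1 : h.domChart p ∈ (h.domChart.extend (𝓡 2)).target := by
      simpa using h.domChart.map_source h.mem_domChart_source
    have h2 := h.writtenInCharts h1
    simp only [Function.comp_apply, OpenPartialHomeomorph.extend_coe,
      OpenPartialHomeomorph.extend_coe_symm, modelWithCornersSelf_coe,
      modelWithCornersSelf_coe_symm, id, h.domChart.left_inv h.mem_domChart_source] at h2
    simp [L, h2]
  have hρ : MDifferentiableAt 𝓘(ℝ, E4) (𝓡 2) ρ (f p) := by
    have h1 : MDifferentiableAt 𝓘(ℝ, E4) 𝓘(ℝ, E4) h.codChart (f p) :=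
      mdifferentiableAt_of_mem_maximalAtlas
        (IsManifold.maximalAtlas_subset_of_le (by simp) h.codChart_mem_maximalAtlas)
        h.mem_codChart_source
    have h2 : MDifferentiableAt 𝓘(ℝ, E4) 𝓘(ℝ, EuclideanSpace ℝ (Fin 2)) (L ∘ h.equiv.symm)
        (h.codChart (f p)) :=
      (L.differentiableAt.comp _ h.equiv.symm.differentiableAt).mdifferentiableAt
    have h3 : MDifferentiableAt (𝓡 2) (𝓡 2) h.domChart.symm
        ((L ∘ h.equiv.symm) (h.codChart (f p))) := by
      rw [hval]
      exact mdifferentiableAt_symm_of_mem_maximalAtlas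
        (IsManifold.maximalAtlas_subset_of_le (by simp) h.domChart_mem_maximalAtlas)
        (h.domChart.map_source h.mem_domChart_source)
    exact h3.comp (f p) (h2.comp (f p) h1)
  have hfd : MDifferentiableAt (𝓡 2) 𝓘(ℝ, E4) f p :=
    (hf.contMDiff p).mdifferentiableAt (by simp)
  have hcomp : HasMFDerivAt (𝓡 2) (𝓡 2) (ρ ∘ f) p
      ((mfderiv 𝓘(ℝ, E4) (𝓡 2) ρ (f p)).comp (surfDiff f p)) :=
    hρ.hasMFDerivAt.comp p hfd.hasMFDerivAt
  have hid : HasMFDerivAt (𝓡 2) (𝓡 2) (ρ ∘ f) p 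
      (ContinuousLinearMap.id ℝ (TangentSpace (𝓡 2) p)) := by
    refine (hasMFDerivAt_id p).congr_of_eventuallyEq ?_
    filter_upwards [h.domChart.open_source.mem_nhds h.mem_domChart_source] with q hq
    exact hρf q hq
  have heq := hasMFDerivAt_unique hcomp hid
  exact Function.LeftInverse.injective (g := mfderiv 𝓘(ℝ, E4) (𝓡 2) ρ (f p)) fun v =>
    congrArg (fun A => A v) heq

theorem finrank_tangentPlane [IsManifold (𝓡 2) ∞ M]
    (hf : Manifold.IsImmersion (𝓡 2) 𝓘(ℝ, E4) ∞ f) (p : M) :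
    Module.finrank ℝ (tangentPlane f p) = 2 := by
  have h := LinearMap.finrank_range_of_inj (f := (surfDiff f p).toLinearMap)
    (surfDiff_injective hf p)
  have h2 : Module.finrank ℝ (TangentSpace (𝓡 2) p) = 2 :=
    finrank_euclideanSpace_fin (𝕜 := ℝ) (n := 2)
  exact h.trans h2

variable {X : Type*} [NormedAddCommGroup X] [NormedSpace ℝ X]

theorem fderiv_comp_surface (hf : ContMDiff (𝓡 2) 𝓘(ℝ, E4) ∞ f) {g : X → M} {x : X}
    (hg : MDifferentiableAt 𝓘(ℝ, X) (𝓡 2) g x) (v : X) :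
    fderiv ℝ (f ∘ g) x v = surfDiff f (g x) (mfderiv 𝓘(ℝ, X) (𝓡 2) g x v) := by
  have h := mfderiv_comp x ((hf (g x)).mdifferentiableAt (by simp)) hg
  rw [mfderiv_eq_fderiv] at h
  exact congrArg (fun A => A v) h

theorem fderiv_comp_mem_tangentPlane (hf : ContMDiff (𝓡 2) 𝓘(ℝ, E4) ∞ f) {g : X → M} {x : X}
    (hg : MDifferentiableAt 𝓘(ℝ, X) (𝓡 2) g x) (v : X) :
    fderiv ℝ (f ∘ g) x v ∈ tangentPlane f (g x) := by
  rw [fderiv_comp_surface hf hg]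
  exact ⟨_, rfl⟩

section Chart

variable [IsManifold (𝓡 2) ∞ M] (q : M)

theorem contDiffOn_comp_chart_symm (hf : ContMDiff (𝓡 2) 𝓘(ℝ, E4) ∞ f) :
    ContDiffOn ℝ ∞ (f ∘ (chartAt (EuclideanSpace ℝ (Fin 2)) q).symm)
      (chartAt (EuclideanSpace ℝ (Fin 2)) q).target :=
  contMDiffOn_iff_contDiffOn.mp (hf.comp_contMDiffOn (contMDiffOn_chart_symm (I := 𝓡 2)))

theorem mdifferentiableAt_chart_symm {x : EuclideanSpace ℝ (Fin 2)}
    (hx : x ∈ (chartAt (EuclideanSpace ℝ (Fin 2)) q).target) :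
    MDifferentiableAt (𝓡 2) (𝓡 2) (chartAt (EuclideanSpace ℝ (Fin 2)) q).symm x :=
  ((contMDiffOn_chart_symm (I := 𝓡 2) (n := ∞) (x := q)).contMDiffAt
    ((chartAt _ q).open_target.mem_nhds hx)).mdifferentiableAt (by simp)

theorem fderiv_comp_chart_symm_injective (hf : Manifold.IsImmersion (𝓡 2) 𝓘(ℝ, E4) ∞ f)
    {x : EuclideanSpace ℝ (Fin 2)} (hx : x ∈ (chartAt (EuclideanSpace ℝ (Fin 2)) q).target) :
    Function.Injective (fderiv ℝ (f ∘ (chartAt (EuclideanSpace ℝ (Fin 2)) q).symm) x) := by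
  have : IsManifold (𝓡 2) 1 M := IsManifold.of_le (n := ∞) (by simp)
  have h1 := (mdifferentiable_chart (I := 𝓡 2) q).symm.mfderiv_injective hx
  intro v w hvw
  rw [fderiv_comp_surface hf.contMDiff (mdifferentiableAt_chart_symm q hx),
    fderiv_comp_surface hf.contMDiff (mdifferentiableAt_chart_symm q hx)] at hvw
  exact h1 (surfDiff_injective hf _ hvw)

theorem range_fderiv_comp_chart_symm (hf : Manifold.IsImmersion (𝓡 2) 𝓘(ℝ, E4) ∞ f)
    {x : EuclideanSpace ℝ (Fin 2)} (hx : x ∈ (chartAt (EuclideanSpace ℝ (Fin 2)) q).target) :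
    (fderiv ℝ (f ∘ (chartAt (EuclideanSpace ℝ (Fin 2)) q).symm) x).toLinearMap.range =
      tangentPlane f ((chartAt (EuclideanSpace ℝ (Fin 2)) q).symm x) := by
  refine Submodule.eq_of_le_of_finrank_eq ?_ ?_
  · rintro _ ⟨v, rfl⟩
    exact fderiv_comp_mem_tangentPlane hf.contMDiff (mdifferentiableAt_chart_symm q hx) v
  · rw [finrank_tangentPlane hf, LinearMap.finrank_range_of_inj
      (fderiv_comp_chart_symm_injective q hf hx), finrank_euclideanSpace_fin]

end Chart

/-- The tangent planes of the surface split orthogonally along `V` and `Vᗮ`. -/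
def SplitsAlong (f : M → E4) (V : Submodule ℝ E4) : Prop :=
  ∀ p, (∃ w ∈ tangentPlane f p, w ∈ V ∧ ‖w‖ = 1) ∧ ∃ w ∈ tangentPlane f p, w ∈ Vᗮ ∧ ‖w‖ = 1

theorem exists_product_chart [IsManifold (𝓡 2) ∞ M]
    (hf : Manifold.IsImmersion (𝓡 2) 𝓘(ℝ, E4) ∞ f) {V : Submodule ℝ E4}
    (hV : SplitsAlong f V) (q : M) :
    ∃ e : OpenPartialHomeomorph M (ℝ × ℝ), q ∈ e.source ∧ e q = 0 ∧
      ContMDiffOn (𝓡 2) 𝓘(ℝ, ℝ × ℝ) ∞ e e.source ∧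
      ContMDiffOn 𝓘(ℝ, ℝ × ℝ) (𝓡 2) ∞ e.symm e.target ∧
      (∃ r > 0, e.target = ball 0 r) ∧
      ∀ z ∈ e.target, IsSplitDeriv V (fderiv ℝ (f ∘ e.symm) z) := by
  let c := chartAt (EuclideanSpace ℝ (Fin 2)) q
  have hrange : ∀ x ∈ c.target, ∀ w ∈ tangentPlane f (c.symm x),
      ∃ y, fderiv ℝ (f ∘ c.symm) x y = w := by
    intro x hx w hw
    rw [← range_fderiv_comp_chart_symm q hf hx] at hw
    exact hw
  obtain ⟨e, hqe, hes, heq, he, hesymm, ⟨r, hr, htarget⟩, hsplit⟩ := exists_flat_product_chart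
    (by simp) c.open_target (contDiffOn_comp_chart_symm q hf.contMDiff)
    (fun x hx => fderiv_comp_chart_symm_injective q hf hx) (V := V)
    (fun x hx => by
      obtain ⟨w, hw, h⟩ := (hV (c.symm x)).1
      obtain ⟨y, rfl⟩ := hrange x hx w hw
      exact ⟨y, h⟩)
    (fun x hx => by
      obtain ⟨w, hw, h⟩ := (hV (c.symm x)).2
      obtain ⟨y, rfl⟩ := hrange x hx w hw
      exact ⟨y, h⟩)
    (c.map_source (mem_chart_source _ q))
  have ht : (c.trans e).target = ball 0 r := by
    rw [← htarget]
    exact inter_eq_left.mpr fun z hz => hes (e.map_target hz)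
  refine ⟨c.trans e, ⟨mem_chart_source _ q, hqe⟩, heq, ?_, ?_, ⟨r, hr, ht⟩, fun z hz => ?_⟩
  · exact (contMDiffOn_iff_contDiffOn.mpr he).comp
      ((contMDiffOn_chart (I := 𝓡 2) (x := q)).mono fun x hx => hx.1) fun x hx => hx.2
  · exact (contMDiffOn_chart_symm (I := 𝓡 2) (x := q)).comp
      ((contMDiffOn_iff_contDiffOn.mpr hesymm).mono fun x hx => hx.1) fun x hx => hx.2
  · exact hsplit z hz.1

theorem exists_chart_of_injOn_tangentPlane [IsManifold (𝓡 2) ∞ M] [FiniteDimensional ℝ X]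
    (hX : Module.finrank ℝ X = 2) (hf : Manifold.IsImmersion (𝓡 2) 𝓘(ℝ, E4) ∞ f) (L : E4 →L[ℝ] X)
    (q : M) (hL : ∀ w ∈ tangentPlane f q, L w = 0 → w = 0) :
    ∃ e : OpenPartialHomeomorph M X, q ∈ e.source ∧ (∀ x ∈ e.source, e x = L (f x)) ∧
      ContMDiffOn 𝓘(ℝ, X) (𝓡 2) ∞ e.symm e.target ∧ ∃ r > 0, e.target = ball (L (f q)) r := by
  let c := chartAt (EuclideanSpace ℝ (Fin 2)) q
  have hq := mem_chart_source (EuclideanSpace ℝ (Fin 2)) q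
  have hcq := c.map_source hq
  have hF := contDiffOn_comp_chart_symm q hf.contMDiff
  have hFq := ((hF.contDiffAt (c.open_target.mem_nhds hcq)).differentiableAt (by simp)).hasFDerivAt
  obtain ⟨e, hqe, hes, hcoe, hesymm, r, hr, htarget⟩ := exists_openPartialHomeomorph_of_injective
    (F := X) (by rw [hX, finrank_euclideanSpace_fin]) c.open_target (L.contDiff.comp_contDiffOn hF)
    hcq (by
      rw [(L.hasFDerivAt.comp _ hFq).fderiv, injective_iff_map_eq_zero]
      intro v hv
      have hmem := fderiv_comp_mem_tangentPlane hf.contMDiff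
        (mdifferentiableAt_chart_symm q hcq) v
      rw [c.left_inv hq] at hmem
      refine fderiv_comp_chart_symm_injective q hf hcq ?_
      rw [hL _ hmem hv, map_zero])
  have hq' : (L ∘ f ∘ c.symm) (c q) = L (f q) := by simp [c.left_inv hq]
  have ht : (c.trans e).target = ball (L (f q)) r := by
    rw [← hq', ← htarget]
    exact inter_eq_left.mpr fun z hz => hes (e.map_target hz)
  refine ⟨c.trans e, ⟨hq, hqe⟩, fun x hx => ?_, ?_, r, hr, ht⟩
  · change e (c x) = _
    rw [hcoe]
    change L (f (c.symm (c x))) = _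
    rw [c.left_inv hx.1]
  · exact (contMDiffOn_chart_symm (I := 𝓡 2) (x := q)).comp
      ((contMDiffOn_iff_contDiffOn.mpr hesymm).mono fun x hx => hx.1) fun x hx => hx.2

theorem inducedEDist_le (hf : ContMDiff (𝓡 2) 𝓘(ℝ, E4) ∞ f) {c : ℝ → M} {K a b : ℝ}
    (hab : a ≤ b) (hc : ∀ t ∈ Icc a b, ContMDiffAt 𝓘(ℝ, ℝ) (𝓡 2) ∞ c t)
    (hK : ∀ t ∈ Icc a b, ‖fderiv ℝ (f ∘ c) t 1‖ ≤ K) :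
    inducedEDist f (c a) (c b) ≤ ENNReal.ofReal (K * (b - a)) ∧
      inducedEDist f (c b) (c a) ≤ ENNReal.ofReal (K * (b - a)) := by
  let : ∀ p : M, ENorm (TangentSpace (𝓡 2) p) := fun p => ⟨fun v => ‖surfDiff f p v‖ₑ⟩
  have : ∀ p : M, ENormSMulClass ℝ (TangentSpace (𝓡 2) p) := fun p =>
    ⟨fun r v => by
      change ‖surfDiff f p (r • v)‖ₑ = ‖r‖ₑ * ‖surfDiff f p v‖ₑ
      rw [map_smul, enorm_smul]⟩
  have hK0 : 0 ≤ K := (norm_nonneg _).trans (hK a ⟨le_rfl, hab⟩)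
  have key : Manifold.riemannianEDist (𝓡 2) (c a) (c b) ≤ ENNReal.ofReal (K * (b - a)) := by
    refine (Manifold.riemannianEDist_le_pathELength (γ := c) (fun t ht =>
      ((hc t ht).of_le (by simp)).contMDiffWithinAt) rfl rfl hab).trans ?_
    rw [Manifold.pathELength_eq_lintegral_mfderiv_Icc]
    calc _ ≤ ∫⁻ _ in Icc a b, ENNReal.ofReal K := by
          refine MeasureTheory.setLIntegral_mono measurable_const fun t ht => ?_
          change ‖surfDiff f (c t) (mfderiv 𝓘(ℝ, ℝ) (𝓡 2) c t 1)‖ₑ ≤ _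
          rw [← ofReal_norm]
          refine ENNReal.ofReal_le_ofReal ?_
          have := hK t ht
          rwa [fderiv_comp_surface hf ((hc t ht).mdifferentiableAt (by simp))] at this
      _ = ENNReal.ofReal (K * (b - a)) := by
          rw [MeasureTheory.setLIntegral_const, Real.volume_Icc, ← ENNReal.ofReal_mul hK0]
  exact ⟨key, by rw [Manifold.riemannianEDist_comm] at key; exact key⟩

/-- On a complete surface, a curve of bounded speed on `[0, 1)` has a limit. -/
theorem IsCompleteSurface.exists_tendsto (hcomplete : IsCompleteSurface f) [T2Space M]
    (hf : ContMDiff (𝓡 2) 𝓘(ℝ, E4) ∞ f) {c : ℝ → M} {K : ℝ}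
    (hc : ∀ t ∈ Ico (0 : ℝ) 1, ContMDiffAt 𝓘(ℝ, ℝ) (𝓡 2) ∞ c t)
    (hK : ∀ t ∈ Ico (0 : ℝ) 1, ‖fderiv ℝ (f ∘ c) t 1‖ ≤ K) :
    ∃ q, Filter.Tendsto c (𝓝[<] 1) (𝓝 q) := by
  have hK0 : 0 ≤ K := (norm_nonneg _).trans (hK 0 ⟨le_rfl, zero_lt_one⟩)
  have hdist : ∀ a ∈ Ico (0 : ℝ) 1, ∀ b ∈ Ico (0 : ℝ) 1,
      inducedEDist f (c a) (c b) ≤ ENNReal.ofReal (K * |b - a|) := by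
    intro a ha b hb
    rcases le_total a b with hab | hab
    · rw [abs_of_nonneg (sub_nonneg.mpr hab)]
      exact (inducedEDist_le hf hab (fun t ht => hc t ⟨ha.1.trans ht.1, ht.2.trans_lt hb.2⟩)
        fun t ht => hK t ⟨ha.1.trans ht.1, ht.2.trans_lt hb.2⟩).1
    · rw [abs_sub_comm, abs_of_nonneg (sub_nonneg.mpr hab)]
      exact (inducedEDist_le hf hab (fun t ht => hc t ⟨hb.1.trans ht.1, ht.2.trans_lt ha.2⟩)
        fun t ht => hK t ⟨hb.1.trans ht.1, ht.2.trans_lt ha.2⟩).2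
  have hseq : ∀ u : ℕ → ℝ, (∀ n, u n ∈ Ico (0 : ℝ) 1) → Filter.Tendsto u Filter.atTop (𝓝 1) →
      ∃ q, Filter.Tendsto (fun n => c (u n)) Filter.atTop (𝓝 q) := by
    intro u hu hlim
    refine hcomplete _ fun ε hε => ?_
    have hcauchy := hlim.cauchySeq
    obtain ⟨δ, hδ, hδε⟩ : ∃ δ > 0, ENNReal.ofReal (K * δ) < ε := by
      have h1 : Filter.Tendsto (fun δ : ℝ => ENNReal.ofReal (K * δ)) (𝓝[>] 0) (𝓝 0) := by
        have h2 : Continuous fun δ : ℝ => ENNReal.ofReal (K * δ) :=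
          ENNReal.continuous_ofReal.comp (continuous_const_mul K)
        have h3 := h2.tendsto 0
        simp only [mul_zero, ENNReal.ofReal_zero] at h3
        exact h3.mono_left nhdsWithin_le_nhds
      obtain ⟨δ, h2, h3⟩ := ((h1.eventually (gt_mem_nhds hε)).and self_mem_nhdsWithin).exists
      exact ⟨δ, h3, h2⟩
    obtain ⟨n₀, hn₀⟩ := Metric.cauchySeq_iff.mp hcauchy δ hδ
    refine ⟨n₀, fun m hm n hn => (hdist _ (hu m) _ (hu n)).trans_lt (lt_of_le_of_lt ?_ hδε)⟩
    refine ENNReal.ofReal_le_ofReal (mul_le_mul_of_nonneg_left ?_ hK0)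
    exact (hn₀ n hn m hm).le
  let u₀ : ℕ → ℝ := fun n => 1 - 1 / ((n : ℝ) + 1)
  have hu₀ : ∀ n, u₀ n ∈ Ico (0 : ℝ) 1 := fun n => by
    have h1 : 0 < 1 / ((n : ℝ) + 1) := Nat.one_div_pos_of_nat
    have h2 : 1 / ((n : ℝ) + 1) ≤ 1 := (div_le_one (by positivity)).mpr
      (by linarith [n.cast_nonneg (α := ℝ)])
    exact ⟨by simp only [u₀]; linarith, by simp only [u₀]; linarith⟩
  have hu₀lim : Filter.Tendsto u₀ Filter.atTop (𝓝 1) := by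
    simpa [u₀] using tendsto_one_div_add_atTop_nhds_zero_nat.const_sub (1 : ℝ)
  obtain ⟨q, hq⟩ := hseq u₀ hu₀ hu₀lim
  refine ⟨q, Filter.tendsto_of_seq_tendsto fun u hu => ?_⟩
  obtain ⟨hu1, hu2⟩ := tendsto_nhdsWithin_iff.mp hu
  have hu3 : ∀ᶠ n in Filter.atTop, u n ∈ Ico (0 : ℝ) 1 := by
    filter_upwards [hu2, hu1.eventually (lt_mem_nhds zero_lt_one)] with n h1 h2
    exact ⟨h2.le, h1⟩
  classical
  -- The sequence lies in `[0, 1)` only eventually; the other terms are replaced by those of `u₀`.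
  let u' : ℕ → ℝ := fun n => if u n ∈ Ico (0 : ℝ) 1 then u n else u₀ n
  have hu' : ∀ n, u' n ∈ Ico (0 : ℝ) 1 := fun n => by
    simp only [u']
    split_ifs with h
    exacts [h, hu₀ n]
  have hu'lim : Filter.Tendsto u' Filter.atTop (𝓝 1) := hu1.if' hu₀lim
  -- Interleaving with the reference sequence `u₀` forces all these sequences to have the same limit
  -- `q`.
  let w : ℕ → ℝ := fun n => if Even n then u₀ (n / 2) else u' (n / 2)
  have hw : ∀ n, w n ∈ Ico (0 : ℝ) 1 := fun n => by
    simp only [w]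
    split_ifs
    exacts [hu₀ _, hu' _]
  have hdiv : Filter.Tendsto (fun n : ℕ => n / 2) Filter.atTop Filter.atTop :=
    Nat.tendsto_div_const_atTop (by norm_num)
  obtain ⟨q', hq'⟩ := hseq w hw ((hu₀lim.comp hdiv).if' (hu'lim.comp hdiv))
  have heven : Filter.Tendsto (fun n : ℕ => 2 * n) Filter.atTop Filter.atTop :=
    Filter.tendsto_atTop_mono (fun n => by simp only [id]; omega) Filter.tendsto_id
  have hodd : Filter.Tendsto (fun n : ℕ => 2 * n + 1) Filter.atTop Filter.atTop :=
    Filter.tendsto_atTop_mono (fun n => by simp only [id]; omega) Filter.tendsto_id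
  have hqq' : q' = q := by
    refine tendsto_nhds_unique ((hq'.comp heven).congr fun n => ?_) hq
    simp [w]
  rw [← hqq']
  refine (hq'.comp hodd).congr' ?_
  filter_upwards [hu3] with n hn
  have h1 : ¬ Even (2 * n + 1) := by simp
  have h2 : (2 * n + 1) / 2 = n := by omega
  simp only [Function.comp_apply, w, h1, if_false, h2, u', hn, if_true]

end SurfaceBasics

end
noncomputable section

/-! ### Product maps from the plane into a surface with split tangent planes -/

section ProductMaps

open Metric Set

/-- Multiplication by a pair of signs. -/
def signMul (ε : ℝ × ℝ) : ℝ × ℝ →L[ℝ] ℝ × ℝ := ContinuousLinearMap.mul ℝ (ℝ × ℝ) ε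

@[simp] theorem signMul_apply (ε w : ℝ × ℝ) : signMul ε w = ε * w := rfl

theorem sq_eq_one_of_mul_self {ε : ℝ × ℝ} (hε : ε * ε = 1) :
    ε.1 * ε.1 = 1 ∧ ε.2 * ε.2 = 1 :=
  ⟨congrArg Prod.fst hε, congrArg Prod.snd hε⟩

theorem norm_sign_mul {ε : ℝ × ℝ} (hε : ε * ε = 1) (w : ℝ × ℝ) : ‖ε * w‖ = ‖w‖ := by
  obtain ⟨h1, h2⟩ := sq_eq_one_of_mul_self hε
  have h1' : |ε.1| = 1 := by rcases mul_self_eq_one_iff.mp h1 with h | h <;> simp [h]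
  have h2' : |ε.2| = 1 := by rcases mul_self_eq_one_iff.mp h2 with h | h <;> simp [h]
  simp [Prod.norm_def, h1', h2']

theorem sign_mul_cancel {ε : ℝ × ℝ} (hε : ε * ε = 1) (w : ℝ × ℝ) : ε * (ε * w) = w := by
  rw [← mul_assoc, hε, one_mul]

section Linear

variable {N : Type*} [NormedAddCommGroup N] [InnerProductSpace ℝ N] {V : Submodule ℝ N}
  {A : ℝ × ℝ →L[ℝ] N}

theorem clm_prod_apply (A : ℝ × ℝ →L[ℝ] N) (w : ℝ × ℝ) :
    A w = w.1 • A (1, 0) + w.2 • A (0, 1) := by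
  rw [← map_smul, ← map_smul, ← map_add]
  congr 1
  ext <;> simp

theorem IsSplitDeriv.injective (hA : IsSplitDeriv V A) : Function.Injective A := by
  rw [injective_iff_map_eq_zero]
  intro w hw
  obtain ⟨h1, h2, h3, h4⟩ := hA
  have h5 : ⟪A (1, 0), A (0, 1)⟫ = 0 := h3 _ h1
  rw [clm_prod_apply] at hw
  have h6 := congrArg (fun z => ⟪A (1, 0), z⟫) hw
  have h7 := congrArg (fun z => ⟪A (0, 1), z⟫) hw
  simp only [inner_add_right, inner_smul_right, real_inner_self_eq_norm_sq, h2, h4, h5,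
    inner_zero_right] at h6 h7
  rw [real_inner_comm, h5] at h7
  ext <;> simp <;> linarith

/-- A linear map that relates two split differentials is a pair of signs. -/
theorem IsSplitDeriv.exists_sign (hA : IsSplitDeriv V A) {B : ℝ × ℝ →L[ℝ] ℝ × ℝ}
    (hB : IsSplitDeriv V (A.comp B)) : ∃ ε : ℝ × ℝ, ε * ε = 1 ∧ B = signMul ε := by
  obtain ⟨h1, h2, h3, h4⟩ := hA
  obtain ⟨k1, k2, k3, k4⟩ := hB
  have h5 : ⟪A (1, 0), A (0, 1)⟫ = 0 := h3 _ h1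
  rw [ContinuousLinearMap.comp_apply, clm_prod_apply] at k1 k2 k3 k4
  have h2' : (B (1, 0)).2 = 0 := by
    have := h3 _ k1
    rw [real_inner_comm, inner_add_right, inner_smul_right, inner_smul_right,
      real_inner_self_eq_norm_sq, h4, real_inner_comm, h5] at this
    linarith
  have h1' : (B (0, 1)).1 = 0 := by
    have := k3 _ h1
    rw [inner_add_right, inner_smul_right, inner_smul_right,
      real_inner_self_eq_norm_sq, h2, h5] at this
    linarith
  rw [h2', zero_smul, add_zero, norm_smul, h2, mul_one, Real.norm_eq_abs] at k2
  rw [h1', zero_smul, zero_add, norm_smul, h4, mul_one, Real.norm_eq_abs] at k4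
  refine ⟨((B (1, 0)).1, (B (0, 1)).2), ?_, ?_⟩
  · ext
    · simp [← abs_mul_abs_self (B (1, 0)).1, k2]
    · simp [← abs_mul_abs_self (B (0, 1)).2, k4]
  · ext <;> simp [h1', h2']

end Linear

variable {M : Type*} [TopologicalSpace M] [ChartedSpace (EuclideanSpace ℝ (Fin 2)) M]
  {f : M → E4} {V : Submodule ℝ E4}

/-- Near `x`, the map `g` from the plane to the surface is smooth and `f ∘ g` is a product of two
unit speed curves in `V` and `Vᗮ`. -/
def IsProductAt (f : M → E4) (V : Submodule ℝ E4) (g : ℝ × ℝ → M) (x : ℝ × ℝ) : Prop :=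
  ContMDiffAt 𝓘(ℝ, ℝ × ℝ) (𝓡 2) ∞ g x ∧ ∀ᶠ y in 𝓝 x, IsSplitDeriv V (fderiv ℝ (f ∘ g) y)

/-- A chart whose inverse is a product map. -/
structure IsProductChart (f : M → E4) (V : Submodule ℝ E4)
    (e : OpenPartialHomeomorph M (ℝ × ℝ)) : Prop where
  smooth : ContMDiffOn (𝓡 2) 𝓘(ℝ, ℝ × ℝ) ∞ e e.source
  smooth_symm : ContMDiffOn 𝓘(ℝ, ℝ × ℝ) (𝓡 2) ∞ e.symm e.target
  split : ∀ z ∈ e.target, IsSplitDeriv V (fderiv ℝ (f ∘ e.symm) z)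

theorem IsProductChart.isProductAt {e : OpenPartialHomeomorph M (ℝ × ℝ)}
    (he : IsProductChart f V e) {z : ℝ × ℝ} (hz : z ∈ e.target) : IsProductAt f V e.symm z := by
  refine ⟨he.smooth_symm.contMDiffAt (e.open_target.mem_nhds hz), ?_⟩
  filter_upwards [e.open_target.mem_nhds hz] with y hy using he.split y hy

theorem IsProductAt.congr {g g' : ℝ × ℝ → M} {x : ℝ × ℝ} (h : g =ᶠ[𝓝 x] g')
    (hg : IsProductAt f V g x) : IsProductAt f V g' x := by
  refine ⟨hg.1.congr_of_eventuallyEq h.symm, ?_⟩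
  filter_upwards [hg.2, eventually_eventually_nhds.mpr h] with y hy hyg
  have hyg' : g =ᶠ[𝓝 y] g' := hyg
  rwa [← (show f ∘ g =ᶠ[𝓝 y] f ∘ g' from hyg'.fun_comp f).fderiv_eq]

theorem IsProductAt.contDiffAt (hf : ContMDiff (𝓡 2) 𝓘(ℝ, E4) ∞ f) {g : ℝ × ℝ → M} {x : ℝ × ℝ}
    (hg : IsProductAt f V g x) : ContDiffAt ℝ ∞ (f ∘ g) x :=
  contMDiffAt_iff_contDiffAt.mp ((hf (g x)).comp x hg.1)

theorem IsProductAt.continuousAt_fderiv (hf : ContMDiff (𝓡 2) 𝓘(ℝ, E4) ∞ f) {g : ℝ × ℝ → M}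
    {x : ℝ × ℝ} (hg : IsProductAt f V g x) : ContinuousAt (fderiv ℝ (f ∘ g)) x :=
  ((hg.contDiffAt hf).fderiv_right (m := 0) (by simp)).continuousAt

/-- A product map precomposed with translations and reflections of the axes is a product map. -/
theorem IsProductAt.comp_sign (hf : ContMDiff (𝓡 2) 𝓘(ℝ, E4) ∞ f) {g : ℝ × ℝ → M}
    {ε : ℝ × ℝ} (hε : ε * ε = 1) {a b x : ℝ × ℝ} (hg : IsProductAt f V g (a + ε * (x - b))) :
    IsProductAt f V (fun y => g (a + ε * (y - b))) x := by
  have hd : ∀ y, HasFDerivAt (fun y => a + ε * (y - b)) (signMul ε) y := fun y =>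
    ((signMul ε).hasFDerivAt.comp y ((hasFDerivAt_id y).sub_const b)).const_add a
  have hc : ContDiff ℝ ∞ fun y => a + ε * (y - b) := by
    have : ContDiff ℝ ∞ fun y => a + signMul ε (y - b) :=
      contDiff_const.add ((signMul ε).contDiff.comp (contDiff_id.sub contDiff_const))
    exact this
  refine ⟨hg.1.comp x hc.contDiffAt.contMDiffAt, ?_⟩
  have h1 : ∀ᶠ z in 𝓝 (a + ε * (x - b)), DifferentiableAt ℝ (f ∘ g) z := by
    filter_upwards [((hg.contDiffAt hf).of_le (m := 1) (by simp)).eventually (by simp)] with z hz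
    exact hz.differentiableAt (by simp)
  filter_upwards [hc.continuous.continuousAt.eventually (hg.2.and h1)] with y hy
  obtain ⟨⟨a1, a2, a3, a4⟩, hdy⟩ := hy
  have h2 : HasFDerivAt ((f ∘ g) ∘ fun y => a + ε * (y - b)) _ y :=
    hdy.hasFDerivAt.comp y (hd y)
  have h3 : fderiv ℝ (f ∘ fun y => g (a + ε * (y - b))) y = _ := h2.fderiv
  obtain ⟨s1, s2⟩ := sq_eq_one_of_mul_self hε
  have e1 : signMul ε (1, 0) = ε.1 • ((1, 0) : ℝ × ℝ) := by ext <;> simp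
  have e2 : signMul ε (0, 1) = ε.2 • ((0, 1) : ℝ × ℝ) := by ext <;> simp
  rw [h3]
  simp only [IsSplitDeriv, ContinuousLinearMap.comp_apply]
  rw [e1, e2, map_smul, map_smul, norm_smul, norm_smul, a2, a4]
  refine ⟨V.smul_mem _ a1, ?_, Vᗮ.smul_mem _ a3, ?_⟩
  · rcases mul_self_eq_one_iff.mp s1 with h | h <;> simp [h]
  · rcases mul_self_eq_one_iff.mp s2 with h | h <;> simp [h]

/-- In a product chart, a product map is a translation composed with reflections of the axes. -/
theorem IsProductAt.exists_sign [IsManifold (𝓡 2) ∞ M] (hf : ContMDiff (𝓡 2) 𝓘(ℝ, E4) ∞ f)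
    {g : ℝ × ℝ → M} {x : ℝ × ℝ}
    (hg : IsProductAt f V g x) {e : OpenPartialHomeomorph M (ℝ × ℝ)}
    (he : IsProductChart f V e) (hx : g x ∈ e.source) :
    ∃ ε : ℝ × ℝ, ε * ε = 1 ∧
      (∀ w, fderiv ℝ (f ∘ g) x w = fderiv ℝ (f ∘ e.symm) (e (g x)) (ε * w)) ∧
      ∀ᶠ y in 𝓝 x, g y ∈ e.source ∧ e (g y) = e (g x) + ε * (y - x) := by
  let h : ℝ × ℝ → ℝ × ℝ := e ∘ g
  have hsrc : ∀ᶠ y in 𝓝 x, g y ∈ e.source :=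
    hg.1.continuousAt.eventually (e.open_source.mem_nhds hx)
  have hh : ContDiffAt ℝ ∞ h x := contMDiffAt_iff_contDiffAt.mp
    ((he.smooth.contMDiffAt (e.open_source.mem_nhds hx)).comp x hg.1)
  have hhd : ∀ᶠ y in 𝓝 x, DifferentiableAt ℝ h y := by
    filter_upwards [(hh.of_le (m := 1) (by simp)).eventually (by simp)] with z hz
    exact hz.differentiableAt (by simp)
  have hhc : ContinuousAt (fderiv ℝ h) x := (hh.fderiv_right (m := 0) (by simp)).continuousAt
  have hed : ∀ z ∈ e.target, DifferentiableAt ℝ (f ∘ e.symm) z := fun z hz =>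
    ((he.isProductAt hz).contDiffAt hf).differentiableAt (by simp)
  have hcomp : ∀ᶠ y in 𝓝 x, fderiv ℝ (f ∘ g) y =
      (fderiv ℝ (f ∘ e.symm) (h y)).comp (fderiv ℝ h y) := by
    filter_upwards [hhd, eventually_eventually_nhds.mpr hsrc] with y hy hys
    have h1 : HasFDerivAt ((f ∘ e.symm) ∘ h) _ y :=
      (hed _ (e.map_source hys.self_of_nhds)).hasFDerivAt.comp y hy.hasFDerivAt
    refine Eq.trans ?_ h1.fderiv
    refine Filter.EventuallyEq.fderiv_eq ?_
    filter_upwards [hys] with z hz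
    simp [h, e.left_inv hz]
  have hsign : ∀ᶠ y in 𝓝 x, ∃ ε : ℝ × ℝ, ε * ε = 1 ∧ fderiv ℝ h y = signMul ε := by
    filter_upwards [hcomp, hg.2, hsrc] with y h1 h2 h3
    exact (he.split _ (e.map_source h3)).exists_sign (by rwa [h1] at h2)
  obtain ⟨ε, hε, hhx⟩ := hsign.self_of_nhds
  -- The signs are recovered by applying the derivative to `1 = (1, 1)`. Different sign pairs are at
  -- distance `2`, so continuity at `x` makes the pair constant nearby.
  have hconst : ∀ᶠ y in 𝓝 x, fderiv ℝ h y = signMul ε := by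
    have h1 : ContinuousAt (fun y => fderiv ℝ h y 1) x := hhc.clm_apply continuousAt_const
    have h2 : ∀ᶠ y in 𝓝 x, ‖fderiv ℝ h y 1 - fderiv ℝ h x 1‖ < 1 := by
      have h3 := h1.eventually (Metric.ball_mem_nhds _ one_pos)
      filter_upwards [h3] with y hy
      rwa [dist_eq_norm] at hy
    filter_upwards [hsign, h2] with y hy hy2
    obtain ⟨ε', hε', hy⟩ := hy
    rw [hy, hhx, signMul_apply, signMul_apply, mul_one, mul_one] at hy2
    have h4 : |ε'.1 - ε.1| < 1 := (norm_fst_le (ε' - ε)).trans_lt hy2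
    have h5 : |ε'.2 - ε.2| < 1 := (norm_snd_le (ε' - ε)).trans_lt hy2
    obtain ⟨a1, a2⟩ := sq_eq_one_of_mul_self hε
    obtain ⟨b1, b2⟩ := sq_eq_one_of_mul_self hε'
    rw [hy]
    congr 1
    ext
    · rcases mul_self_eq_one_iff.mp a1 with h | h <;>
      rcases mul_self_eq_one_iff.mp b1 with h' | h' <;> rw [h, h'] at h4 ⊢ <;> norm_num at h4
    · rcases mul_self_eq_one_iff.mp a2 with h | h <;>
      rcases mul_self_eq_one_iff.mp b2 with h' | h' <;> rw [h, h'] at h5 ⊢ <;> norm_num at h5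
  refine ⟨ε, hε, fun w => by rw [hcomp.self_of_nhds, hhx]; rfl, hsrc.and ?_⟩
  obtain ⟨ρ, hρ, hball⟩ := Metric.eventually_nhds_iff_ball.mp (hconst.and hhd)
  have hlin : ∀ y, HasFDerivAt (fun y => h x + ε * (y - x)) (signMul ε) y := fun y =>
    ((signMul ε).hasFDerivAt.comp y ((hasFDerivAt_id y).sub_const x)).const_add (h x)
  have heq := isOpen_ball.eqOn_of_fderiv_eq (𝕜 := ℝ) (convex_ball x ρ).isPreconnected
    (fun y hy => (hball y hy).2.differentiableWithinAt)
    (fun y _ => (hlin y).differentiableAt.differentiableWithinAt)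
    (fun y hy => by rw [(hball y hy).1, (hlin y).fderiv]) (mem_ball_self hρ) (by simp)
  filter_upwards [Metric.ball_mem_nhds x hρ] with y hy using heq hy

theorem exists_isProductChart [IsManifold (𝓡 2) ∞ M]
    (hf : Manifold.IsImmersion (𝓡 2) 𝓘(ℝ, E4) ∞ f) (hV : SplitsAlong f V) (q : M) :
    ∃ e : OpenPartialHomeomorph M (ℝ × ℝ), IsProductChart f V e ∧ q ∈ e.source ∧ e q = 0 ∧
      ∃ r > 0, e.target = ball 0 r := by
  obtain ⟨e, h1, h2, h3, h4, h5, h6⟩ := exists_product_chart hf hV q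
  exact ⟨e, ⟨h3, h4, h6⟩, h1, h2, h5⟩

/-- In a product chart at `g x`, a product map is affine with a sign pair as linear part, hence
determined by its value and by `d(f ∘ g)` at `x`. Both pass to the limit from the nearby points of
agreement, as `M` is Hausdorff. -/
theorem IsProductAt.eventuallyEq [IsManifold (𝓡 2) ∞ M] [T2Space M]
    (hf : Manifold.IsImmersion (𝓡 2) 𝓘(ℝ, E4) ∞ f) (hV : SplitsAlong f V) {g g' : ℝ × ℝ → M}
    {x : ℝ × ℝ} (hg : IsProductAt f V g x) (hg' : IsProductAt f V g' x)
    (h : ∃ᶠ y in 𝓝 x, g =ᶠ[𝓝 y] g') : g =ᶠ[𝓝 x] g' := by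
  have h1 : g x = g' x := tendsto_nhds_unique_of_frequently_eq hg.1.continuousAt
    hg'.1.continuousAt (h.mono fun y hy => hy.self_of_nhds)
  have h2 : fderiv ℝ (f ∘ g) x = fderiv ℝ (f ∘ g') x :=
    tendsto_nhds_unique_of_frequently_eq (hg.continuousAt_fderiv hf.contMDiff)
      (hg'.continuousAt_fderiv hf.contMDiff)
      (h.mono fun y hy => (show f ∘ g =ᶠ[𝓝 y] f ∘ g' from hy.fun_comp f).fderiv_eq)
  obtain ⟨e, he, hq, -⟩ := exists_isProductChart hf hV (g x)
  obtain ⟨ε, hε, hd, hev⟩ := hg.exists_sign hf.contMDiff he hq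
  obtain ⟨ε', hε', hd', hev'⟩ := hg'.exists_sign hf.contMDiff he (h1 ▸ hq)
  have h3 : ε = ε' := by
    have h4 := hd 1
    rw [h2, hd' 1, ← h1, mul_one, mul_one] at h4
    exact ((he.split _ (e.map_source hq)).injective h4).symm
  filter_upwards [hev, hev'] with y hy hy'
  refine e.injOn hy.1 hy'.1 ?_
  rw [hy.2, hy'.2, h1, h3]

/-- On a complete surface whose tangent planes split, product maps extend to the whole plane. -/
theorem exists_global_product_map [IsManifold (𝓡 2) ∞ M] [T2Space M] [Nonempty M]
    (hf : Manifold.IsImmersion (𝓡 2) 𝓘(ℝ, E4) ∞ f) (hcomplete : IsCompleteSurface f)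
    (hV : SplitsAlong f V) : ∃ g : ℝ × ℝ → M, ∀ x, IsProductAt f V g x := by
  obtain ⟨e₀, he₀, -, -, r₀, hr₀, htarget₀⟩ :=
    exists_isProductChart hf hV (Classical.arbitrary M)
  obtain ⟨g, hg, -⟩ := exists_global_continuation (Q := IsProductAt f V)
    (fun g g' x h hg => hg.congr h) (fun g g' x hg hg' h => hg.eventuallyEq hf hV hg' h)
    (fun g z hg => by
      let c : ℝ → M := fun τ => g (τ • z)
      have hline : ContDiff ℝ ∞ fun τ : ℝ => τ • z := contDiff_id.smul contDiff_const
      have hc : ∀ t ∈ Ico (0 : ℝ) 1, ContMDiffAt 𝓘(ℝ, ℝ) (𝓡 2) ∞ c t := fun t ht =>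
        (hg t ht).1.comp t hline.contDiffAt.contMDiffAt
      -- The speed along the ray is bounded by `|z.1| + |z.2|` because both partial derivatives of
      -- `f ∘ g` have length one.
      obtain ⟨q, hq⟩ := hcomplete.exists_tendsto (K := |z.1| + |z.2|) hf.contMDiff hc
        (fun t ht => by
          have h1 : HasDerivAt (fun τ : ℝ => τ • z) z t := by
            simpa using (hasDerivAt_id t).smul_const z
          have h2 : HasDerivAt ((f ∘ g) ∘ fun τ : ℝ => τ • z) _ t :=
            (((hg t ht).contDiffAt hf.contMDiff).differentiableAt
              (by simp)).hasFDerivAt.comp_hasDerivAt t h1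
          have h3 : fderiv ℝ (f ∘ c) t 1 = fderiv ℝ (f ∘ g) (t • z) z := by
            rw [fderiv_apply_one_eq_deriv]; exact h2.deriv
          obtain ⟨a1, a2, a3, a4⟩ := (hg t ht).2.self_of_nhds
          rw [h3, clm_prod_apply]
          refine (norm_add_le _ _).trans ?_
          rw [norm_smul, norm_smul, a2, a4]
          simp)
      obtain ⟨e, he, hqe, he0, r, hr, htarget⟩ := exists_isProductChart hf hV q
      have hcont : ContinuousAt e q := e.continuousAt hqe
      have hev1 : ∀ᶠ m in 𝓝 q, m ∈ e.source ∧ ‖e m‖ < r / 2 := by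
        refine Filter.Eventually.and (e.open_source.mem_nhds hqe) ?_
        refine hcont.norm.eventually (gt_mem_nhds ?_)
        change ‖e q‖ < r / 2
        rw [he0, norm_zero]
        linarith
      have hev2 : ∀ᶠ τ : ℝ in 𝓝[<] 1, ‖z - τ • z‖ < r / 2 := by
        have h1 : ContinuousAt (fun τ : ℝ => ‖z - τ • z‖) 1 := by fun_prop
        refine nhdsWithin_le_nhds (h1.eventually (gt_mem_nhds ?_))
        simp only [one_smul, sub_self, norm_zero]
        linarith
      have hev3 : ∀ᶠ τ : ℝ in 𝓝[<] 1, τ ∈ Ico (0 : ℝ) 1 :=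
        Ico_mem_nhdsLT zero_lt_one
      obtain ⟨τ, ⟨hτ1, hτ2⟩, hτ3, hτ⟩ := ((hq.eventually hev1).and (hev2.and hev3)).exists
      obtain ⟨ε, hε, -, hev⟩ := (hg τ hτ).exists_sign hf.contMDiff he hτ1
      -- The continuation is the chart inverse after the affine map describing `g` near `τ • z`.
      -- Since `e (g (τ • z))` has norm below `r / 2`, the ball of radius `r / 2` is sent into the
      -- target; `z` is in it by the choice of `τ`.
      refine ⟨τ, hτ, fun y => e.symm (e (g (τ • z)) + ε * (y - τ • z)), r / 2, hτ3, ?_, ?_⟩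
      · intro x hx
        refine IsProductAt.comp_sign hf.contMDiff hε (he.isProductAt ?_)
        rw [htarget, mem_ball_zero_iff]
        refine (norm_add_le _ _).trans_lt ?_
        rw [norm_sign_mul hε]
        rw [mem_ball, dist_eq_norm] at hx
        have : ‖e (g (τ • z))‖ < r / 2 := hτ2
        linarith
      · filter_upwards [hev] with y hy
        rw [← hy.2, e.left_inv hy.1])
    hr₀ (fun x hx => he₀.isProductAt (by rwa [htarget₀]))
  exact ⟨g, hg⟩

end ProductMaps

end
noncomputable section

/-! ### Global product maps are coverings -/

section Covering

open Metric Set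

variable {M : Type*} [TopologicalSpace M] [ChartedSpace (EuclideanSpace ℝ (Fin 2)) M]
  {f : M → E4} {V : Submodule ℝ E4} {π : ℝ × ℝ → M} {e : OpenPartialHomeomorph M (ℝ × ℝ)} {r : ℝ}

/-- The `V` component of `f ∘ π` has zero derivative in `t`, since that partial derivative lies in
`Vᗮ`; likewise the `Vᗮ` component does not depend on `s`. -/
theorem comp_eq_add_of_isProductAt (hf : ContMDiff (𝓡 2) 𝓘(ℝ, E4) ∞ f)
    (hπ : ∀ x, IsProductAt f V π x) (s t : ℝ) :
    f (π (s, t)) = V.starProjection (f (π (s, 0))) + Vᗮ.starProjection (f (π (0, t))) := by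
  have hd : ∀ x, HasFDerivAt (f ∘ π) (fderiv ℝ (f ∘ π) x) x := fun x =>
    (((hπ x).contDiffAt hf).differentiableAt (by simp)).hasFDerivAt
  have h1 : ∀ y, HasDerivAt (fun τ : ℝ => V.starProjection (f (π (s, τ)))) 0 y := by
    intro y
    have h2 : HasDerivAt (fun τ : ℝ => (s, τ)) ((0 : ℝ), (1 : ℝ)) y :=
      (hasDerivAt_const y s).prodMk (hasDerivAt_id y)
    have h3 := V.starProjection.hasFDerivAt.comp_hasDerivAt y ((hd (s, y)).comp_hasDerivAt y h2)
    rwa [(Submodule.starProjection_apply_eq_zero_iff _).mpr (hπ (s, y)).2.self_of_nhds.2.2.1] at h3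
  have h4 : ∀ y, HasDerivAt (fun τ : ℝ => Vᗮ.starProjection (f (π (τ, t)))) 0 y := by
    intro y
    have h2 : HasDerivAt (fun τ : ℝ => (τ, t)) ((1 : ℝ), (0 : ℝ)) y :=
      (hasDerivAt_id y).prodMk (hasDerivAt_const y t)
    have h3 := Vᗮ.starProjection.hasFDerivAt.comp_hasDerivAt y ((hd (y, t)).comp_hasDerivAt y h2)
    rwa [(Submodule.starProjection_apply_eq_zero_iff _).mpr
      (V.le_orthogonal_orthogonal (hπ (y, t)).2.self_of_nhds.1)] at h3
  have h5 := is_const_of_deriv_eq_zero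
    (fun y => (h1 y).differentiableAt) (fun y => (h1 y).deriv) t 0
  have h6 := is_const_of_deriv_eq_zero
    (fun y => (h4 y).differentiableAt) (fun y => (h4 y).deriv) s 0
  rw [← h5, ← h6]
  exact (V.starProjection_add_starProjection_orthogonal _).symm

variable [IsManifold (𝓡 2) ∞ M] [T2Space M]

/-- A point of the plane that is mapped into a product chart lies in a ball that is mapped
isometrically onto this chart. -/
theorem IsProductChart.exists_ball (hf : Manifold.IsImmersion (𝓡 2) 𝓘(ℝ, E4) ∞ f)
    (hV : SplitsAlong f V) (hπ : ∀ x, IsProductAt f V π x) (he : IsProductChart f V e)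
    (htarget : e.target = ball 0 r) {y : ℝ × ℝ} (hy : π y ∈ e.source) :
    ∃ x ε : ℝ × ℝ, ε * ε = 1 ∧ y ∈ ball x r ∧
      ∀ w ∈ ball x r, π w ∈ e.source ∧ e (π w) = ε * (w - x) := by
  obtain ⟨ε, hε, -, hev⟩ := (hπ y).exists_sign hf.contMDiff he hy
  have hu : e (π y) ∈ ball 0 r := htarget ▸ e.map_source hy
  have hyx : y ∈ ball (y - ε * e (π y)) r := by
    rw [mem_ball_iff_norm, sub_sub_cancel, norm_sign_mul hε]
    exact mem_ball_zero_iff.mp hu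
  have hball : ∀ w ∈ ball (y - ε * e (π y)) r, 0 + ε * (w - (y - ε * e (π y))) ∈ e.target := by
    intro w hw
    rw [htarget, mem_ball_zero_iff, zero_add, norm_sign_mul hε]
    exact mem_ball_iff_norm.mp hw
  refine ⟨y - ε * e (π y), ε, hε, hyx, fun w hw => ?_⟩
  -- Both `π` and the chart inverse after the affine change of coordinates are product maps on the
  -- whole ball, and they agree near `y`.
  have h1 := (eventuallyEq_of_isPreconnected (Q := IsProductAt f V)
    (fun g g' x hg hg' h => hg.eventuallyEq hf hV hg' h) (convex_ball _ r).isPreconnected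
    (g := π) (g' := fun w => e.symm (0 + ε * (w - (y - ε * e (π y))))) (fun x _ => hπ x)
    (fun x hx => IsProductAt.comp_sign hf.contMDiff hε (he.isProductAt (hball x hx))) hyx
    (by
      filter_upwards [hev] with z hz
      rw [← e.left_inv hz.1, hz.2]
      congr 1
      linear_combination -(e (π y)) * hε) w hw).self_of_nhds
  simp only at h1
  have h2 := hball w hw
  rw [h1]
  refine ⟨e.map_target h2, ?_⟩
  rw [e.right_inv h2, zero_add]

/-- By `IsProductChart.exists_ball`, a product chart domain with target a centred ball lies in the
range of `π` as soon as it meets it. -/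
theorem isClopen_range_of_isProductAt (hf : Manifold.IsImmersion (𝓡 2) 𝓘(ℝ, E4) ∞ f)
    (hV : SplitsAlong f V) (hπ : ∀ x, IsProductAt f V π x) : IsClopen (range π) := by
  have key : ∀ q, ∃ U ∈ 𝓝 q, (U ∩ range π).Nonempty → U ⊆ range π := by
    intro q
    obtain ⟨e, he, hq, -, r, hr, htarget⟩ := exists_isProductChart hf hV q
    refine ⟨e.source, e.open_source.mem_nhds hq, ?_⟩
    rintro ⟨_, hy, ⟨y, rfl⟩⟩ m hm
    obtain ⟨x, ε, hε, -, hx⟩ := he.exists_ball hf hV hπ htarget hy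
    have h1 : x + ε * e m ∈ ball x r := by
      rw [mem_ball_iff_norm, add_sub_cancel_left, norm_sign_mul hε, ← mem_ball_zero_iff, ← htarget]
      exact e.map_source hm
    obtain ⟨h2, h3⟩ := hx _ h1
    rw [add_sub_cancel_left, sign_mul_cancel hε] at h3
    exact ⟨_, e.injOn h2 hm h3⟩
  constructor
  · refine isClosed_iff_nhds.mpr fun q hq => ?_
    obtain ⟨U, hU, h⟩ := key q
    exact h (hq U hU) (mem_of_mem_nhds hU)
  · refine isOpen_iff_mem_nhds.mpr fun q hq => ?_
    obtain ⟨U, hU, h⟩ := key q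
    exact Filter.mem_of_superset hU (h ⟨q, mem_of_mem_nhds hU, hq⟩)

/-- For a chart centred at `q` with target a ball of radius `r`, the preimage of its domain is the
disjoint union of the balls of radius `r` about the points of the fibre, each mapped bijectively
onto the domain. -/
theorem isCoveringMap_of_isProductAt (hf : Manifold.IsImmersion (𝓡 2) 𝓘(ℝ, E4) ∞ f)
    (hV : SplitsAlong f V) (hπ : ∀ x, IsProductAt f V π x) (hsurj : Function.Surjective π) :
    IsCoveringMap π := by
  intro q
  obtain ⟨e, he, hq, he0, r, hr, htarget⟩ := exists_isProductChart hf hV q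
  have hcont : Continuous π := continuous_iff_continuousAt.mpr fun x => (hπ x).1.continuousAt
  have hfib : ∀ x : π ⁻¹' {q}, ∃ ε : ℝ × ℝ, ε * ε = 1 ∧
      ∀ w ∈ ball (x : ℝ × ℝ) r, π w ∈ e.source ∧ e (π w) = ε * (w - x) := by
    rintro ⟨x, hx⟩
    have hx : π x = q := hx
    obtain ⟨x', ε, hε, h1, h2⟩ := he.exists_ball hf hV hπ htarget (y := x) (hx ▸ hq)
    have h3 := (h2 x h1).2
    rw [hx, he0] at h3
    have h4 := sign_mul_cancel hε (x - x')
    rw [← h3, mul_zero, eq_comm, sub_eq_zero] at h4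
    subst h4
    exact ⟨ε, hε, h2⟩
  have hlift : ∀ (x : π ⁻¹' {q}) (ε : ℝ × ℝ), ε * ε = 1 →
      (∀ w ∈ ball (x : ℝ × ℝ) r, π w ∈ e.source ∧ e (π w) = ε * (w - x)) → ∀ m ∈ e.source,
      (x : ℝ × ℝ) + ε * e m ∈ ball (x : ℝ × ℝ) r ∧ π (x + ε * e m) = m := by
    intro x ε hε hx m hm
    have h1 : x + ε * e m ∈ ball (x : ℝ × ℝ) r := by
      rw [mem_ball_iff_norm, add_sub_cancel_left, norm_sign_mul hε, ← mem_ball_zero_iff, ← htarget]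
      exact e.map_source hm
    obtain ⟨h2, h3⟩ := hx _ h1
    rw [add_sub_cancel_left, sign_mul_cancel hε] at h3
    exact ⟨h1, e.injOn h2 hm h3⟩
  -- On an overlap, `e ∘ π` is given by two affine formulas. Moving along `(1, 1)` shows that their
  -- signs agree, and then so do their zeros, the centres.
  have hdisj : ∀ x x' : π ⁻¹' {q}, (ball (x : ℝ × ℝ) r ∩ ball (x' : ℝ × ℝ) r).Nonempty →
      x = x' := by
    rintro x x' ⟨w, hw⟩
    obtain ⟨ε, hε, h⟩ := hfib x
    obtain ⟨ε', hε', h'⟩ := hfib x'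
    have hopen : ∀ᶠ y in 𝓝 w, y ∈ ball (x : ℝ × ℝ) r ∩ ball (x' : ℝ × ℝ) r :=
      (isOpen_ball.inter isOpen_ball).mem_nhds hw
    have hc : Filter.Tendsto (fun t : ℝ => w + t • (1 : ℝ × ℝ)) (𝓝[≠] 0) (𝓝 w) := by
      have : Continuous fun t : ℝ => w + t • (1 : ℝ × ℝ) := by fun_prop
      simpa using (this.tendsto 0).mono_left nhdsWithin_le_nhds
    obtain ⟨t, ht, ht0⟩ := ((hc.eventually hopen).and self_mem_nhdsWithin).exists
    have h1 := (h w hw.1).2.symm.trans (h' w hw.2).2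
    have h2 := (h _ ht.1).2.symm.trans (h' _ ht.2).2
    rw [add_sub_right_comm, add_sub_right_comm, mul_add, mul_add, h1, add_right_inj,
      mul_smul_comm, mul_smul_comm, mul_one, mul_one] at h2
    have h3 : ε = ε' := smul_right_injective _ ht0 h2
    rw [← h3] at h1
    have h4 := sign_mul_cancel hε (w - x)
    rw [h1, sign_mul_cancel hε, sub_right_inj] at h4
    exact Subtype.ext h4.symm
  have : DiscreteTopology (π ⁻¹' {q}) := by
    refine DiscreteTopology.of_forall_le_dist hr fun x x' hne => ?_
    by_contra! hlt
    exact hne (hdisj x x' ⟨x, mem_ball_self hr, hlt⟩)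
  have : Nonempty (π ⁻¹' {q}) := by
    obtain ⟨x, hx⟩ := hsurj q
    exact ⟨⟨x, hx⟩⟩
  refine IsEvenlyCovered.of_trivialization (t := IsOpen.trivializationDiscrete
    (fun x : π ⁻¹' {q} => ball (x : ℝ × ℝ) r) e.source e.open_source ?_ ?_ ?_ ?_ ?_) hq
  · intro x W hW
    obtain ⟨ε, hε, h⟩ := hfib x
    refine ⟨fun hWo => (hWo.preimage hcont).inter isOpen_ball, fun ho => ?_⟩
    have hc : Continuous fun u : ℝ × ℝ => (x : ℝ × ℝ) + ε * u := by fun_prop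
    convert e.isOpen_inter_preimage (ho.preimage hc) using 1
    ext m
    constructor
    · intro hm
      obtain ⟨h1, h2⟩ := hlift x ε hε h m (hW hm)
      exact ⟨hW hm, by rwa [← h2] at hm, h1⟩
    · rintro ⟨hm, h1, -⟩
      obtain ⟨-, h2⟩ := hlift x ε hε h m hm
      rw [← h2]
      exact h1
  · intro x w hw w' hw' hww
    obtain ⟨ε, hε, h⟩ := hfib x
    have h1 := (h w hw).2
    rw [hww, (h w' hw').2] at h1
    have h2 := congrArg (ε * ·) h1
    simpa [sign_mul_cancel hε] using h2.symm
  · intro x m hm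
    obtain ⟨ε, hε, h⟩ := hfib x
    obtain ⟨h1, h2⟩ := hlift x ε hε h m hm
    exact ⟨_, h1, h2⟩
  · intro x x' hne
    refine Set.disjoint_iff_inter_eq_empty.mpr (not_nonempty_iff_eq_empty.mp fun hn => ?_)
    exact hne (hdisj x x' hn)
  · intro y hy
    obtain ⟨x, ε, hε, hyx, h⟩ := he.exists_ball hf hV hπ htarget hy
    have h1 := h x (mem_ball_self hr)
    rw [sub_self, mul_zero, ← he0] at h1
    exact mem_iUnion.mpr ⟨⟨x, e.injOn h1.1 hq h1.2⟩, hyx⟩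

/-- A complete immersed surface whose tangent planes split along `V` is an extrinsic product. -/
theorem SplitsAlong.isExtrinsicProduct [ConnectedSpace M] (hV : SplitsAlong f V)
    (hf : Manifold.IsImmersion (𝓡 2) 𝓘(ℝ, E4) ∞ f) (hcomplete : IsCompleteSurface f) :
    IsExtrinsicProduct f := by
  obtain ⟨π, hπ⟩ := exists_global_product_map hf hcomplete hV
  have hsurj : Function.Surjective π := range_eq_univ.mp
    ((isClopen_range_of_isProductAt hf hV hπ).eq_univ (range_nonempty π))
  have hsm : ContDiff ℝ ∞ (f ∘ π) :=
    contDiff_iff_contDiffAt.mpr fun x => (hπ x).contDiffAt hf.contMDiff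
  have hd : ∀ x, HasFDerivAt (f ∘ π) (fderiv ℝ (f ∘ π) x) x := fun x =>
    ((hsm.differentiable (by simp)) x).hasFDerivAt
  refine ⟨V, fun s => V.starProjection (f (π (s, 0))), fun t => Vᗮ.starProjection (f (π (0, t))), π,
    fun s => V.starProjection_apply_mem _, fun t => Vᗮ.starProjection_apply_mem _, ?_, ?_, ?_, ?_,
    fun x => (hπ x).1, isCoveringMap_of_isProductAt hf hV hπ hsurj, hsurj,
    comp_eq_add_of_isProductAt hf.contMDiff hπ⟩
  · exact V.starProjection.contDiff.comp (hsm.comp (contDiff_id.prodMk contDiff_const))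
  · exact Vᗮ.starProjection.contDiff.comp (hsm.comp (contDiff_const.prodMk contDiff_id))
  · intro s
    have h2 : HasDerivAt (fun τ : ℝ => (τ, (0 : ℝ))) ((1 : ℝ), (0 : ℝ)) s :=
      (hasDerivAt_id s).prodMk (hasDerivAt_const s _)
    have h3 := V.starProjection.hasFDerivAt.comp_hasDerivAt s ((hd (s, 0)).comp_hasDerivAt s h2)
    obtain ⟨a1, a2, -⟩ := (hπ (s, 0)).2.self_of_nhds
    rw [V.starProjection_eq_self_iff.mpr a1] at h3
    exact (congrArg norm h3.deriv).trans a2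
  · intro t
    have h2 : HasDerivAt (fun τ : ℝ => ((0 : ℝ), τ)) ((0 : ℝ), (1 : ℝ)) t :=
      (hasDerivAt_const t _).prodMk (hasDerivAt_id t)
    have h3 := Vᗮ.starProjection.hasFDerivAt.comp_hasDerivAt t ((hd (0, t)).comp_hasDerivAt t h2)
    obtain ⟨-, -, a1, a2⟩ := (hπ (0, t)).2.self_of_nhds
    rw [Vᗮ.starProjection_eq_self_iff.mpr a1] at h3
    exact (congrArg norm h3.deriv).trans a2

end Covering

end
noncomputable section

/-! ### Planes with a common line -/

section PrincipalBasis

/-- `v₁, v₂` are orthonormal vectors of `T`, the first one lies in `P` and the projection of the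
second one to `P` has length `C`. -/
structure IsPrincipalBasis (T P : Submodule ℝ E4) (C : ℝ) (v₁ v₂ : E4) : Prop where
  mem₁ : v₁ ∈ T
  mem_plane : v₁ ∈ P
  mem₂ : v₂ ∈ T
  norm₁ : ‖v₁‖ = 1
  norm₂ : ‖v₂‖ = 1
  inner_eq : ⟪v₁, v₂⟫ = 0
  norm_proj : ‖P.starProjection v₂‖ = C

variable {T P : Submodule ℝ E4} {C θ : ℝ} {v₁ v₂ : E4}

/-- Equality in Cauchy–Schwarz gives `v₁ = w₁`. For `v` attaining the second maximum the best
partner in `P` is its normalized projection, which is automatically orthogonal to `w₁`; so the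
maximum equals `‖p_P v‖`. -/
theorem IsPrincipalAngles.exists_isPrincipalBasis (h : IsPrincipalAngles T P 0 θ) :
    ∃ v₁ v₂, IsPrincipalBasis T P (Real.cos θ) v₁ v₂ := by
  obtain ⟨-, h0, h2, -, v₁, hv₁, w₁, hw₁, n1, n2, hvw,
    ⟨v, hv, w, hw, a1, a2, a3, a4, a5⟩, hmax⟩ := h
  rw [Real.cos_zero] at hvw
  have hvw := (inner_eq_one_iff_of_norm_eq_one n1 n2).mp hvw.symm
  subst hvw
  refine ⟨v₁, v, hv₁, hw₁, hv, n1, a3, by rwa [real_inner_comm], ?_⟩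
  have hPv : ∀ z ∈ P, ⟪P.starProjection v, z⟫ = ⟪v, z⟫ := fun z hz => by
    rw [P.inner_starProjection_left_eq_right, P.starProjection_eq_self_iff.mpr hz]
  apply le_antisymm
  · by_cases hz : P.starProjection v = 0
    · rw [hz, norm_zero]
      exact Real.cos_nonneg_of_neg_pi_div_two_le_of_le (by linarith [Real.pi_pos]) h2
    have hn : ‖P.starProjection v‖ ≠ 0 := norm_ne_zero_iff.mpr hz
    refine hmax ⟨v, hv, ‖P.starProjection v‖⁻¹ • P.starProjection v,
      P.smul_mem _ (P.starProjection_apply_mem v), a1, ?_, a3, ?_, ?_⟩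
    · rw [real_inner_smul_left, hPv _ hw₁, a1, mul_zero]
    · rw [norm_smul, norm_inv, norm_norm, inv_mul_cancel₀ hn]
    · rw [real_inner_smul_right, ← hPv _ (P.starProjection_apply_mem v),
        real_inner_self_eq_norm_sq, sq, inv_mul_cancel_left₀ hn]
  · rw [a5, ← hPv w hw]
    simpa [a4] using real_inner_le_norm (P.starProjection v) w

theorem norm_sq_starProjection_add (P : Submodule ℝ E4) (v : E4) :
    ‖P.starProjection v‖ ^ 2 + ‖Pᗮ.starProjection v‖ ^ 2 = ‖v‖ ^ 2 := by
  have h := norm_add_sq_eq_norm_sq_add_norm_sq_of_inner_eq_zero (P.starProjection v)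
    (Pᗮ.starProjection v)
    (Pᗮ.starProjection_apply_mem v _ (P.starProjection_apply_mem v))
  rw [P.starProjection_add_starProjection_orthogonal] at h
  rw [sq, sq, sq, h]

theorem IsPrincipalBasis.inner_starProjection (h : IsPrincipalBasis T P C v₁ v₂) :
    ⟪v₁, P.starProjection v₂⟫ = 0 := by
  rw [← P.inner_starProjection_left_eq_right, P.starProjection_eq_self_iff.mpr h.mem_plane,
    h.inner_eq]

theorem IsPrincipalBasis.starProjection_eq (hT : Module.finrank ℝ T = 2)
    (h : IsPrincipalBasis T P C v₁ v₂) {w : E4} (hw : w ∈ T) :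
    P.starProjection w = ⟪v₁, w⟫ • v₁ + ⟪v₂, w⟫ • P.starProjection v₂ := by
  conv_lhs => rw [Submodule.eq_inner_smul_add_inner_smul hT h.mem₁ h.mem₂ h.norm₁ h.norm₂
    h.inner_eq hw, map_add, map_smul, map_smul, P.starProjection_eq_self_iff.mpr h.mem_plane]

theorem IsPrincipalBasis.inner_starProjection_starProjection (hT : Module.finrank ℝ T = 2)
    (h : IsPrincipalBasis T P C v₁ v₂) {w : E4} (hw : w ∈ T) :
    ⟪P.starProjection v₂, P.starProjection w⟫ = C ^ 2 * ⟪v₂, w⟫ := by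
  rw [h.starProjection_eq hT hw, inner_add_right, real_inner_smul_right,
    real_inner_smul_right, real_inner_comm v₁, h.inner_starProjection,
    real_inner_self_eq_norm_sq, h.norm_proj]
  ring

theorem IsPrincipalBasis.norm_sq_starProjection (hT : Module.finrank ℝ T = 2)
    (h : IsPrincipalBasis T P C v₁ v₂) {w : E4} (hw : w ∈ T) :
    ‖P.starProjection w‖ ^ 2 = ⟪v₁, w⟫ ^ 2 + C ^ 2 * ⟪v₂, w⟫ ^ 2 := by
  rw [h.starProjection_eq hT hw, ← real_inner_self_eq_norm_sq]
  simp only [inner_add_left, inner_add_right, real_inner_smul_left, real_inner_smul_right,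
    real_inner_self_eq_norm_sq, norm_smul, mul_pow, h.norm₁, h.norm_proj, h.inner_starProjection,
    real_inner_comm v₁ (P.starProjection v₂), Real.norm_eq_abs, sq_abs]
  ring

theorem IsPrincipalBasis.norm_sq (hT : Module.finrank ℝ T = 2)
    (h : IsPrincipalBasis T P C v₁ v₂) {w : E4} (hw : w ∈ T) :
    ‖w‖ ^ 2 = ⟪v₁, w⟫ ^ 2 + ⟪v₂, w⟫ ^ 2 := by
  have h1 := congrArg (fun z => ⟪z, w⟫) (Submodule.eq_inner_smul_add_inner_smul hT h.mem₁ h.mem₂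
    h.norm₁ h.norm₂ h.inner_eq hw)
  simp only [inner_add_left, real_inner_smul_left, real_inner_self_eq_norm_sq] at h1
  rw [h1]
  ring

/-- For `C > 0` this makes the projection to `P` injective on tangent planes and bounds the speed of
lifted segments. -/
theorem IsPrincipalBasis.le_norm_starProjection (hT : Module.finrank ℝ T = 2) (hC : 0 ≤ C)
    (hC1 : C ≤ 1) (h : IsPrincipalBasis T P C v₁ v₂) {w : E4} (hw : w ∈ T) :
    C * ‖w‖ ≤ ‖P.starProjection w‖ := by
  refine le_of_sq_le_sq ?_ (norm_nonneg _)
  rw [mul_pow, h.norm_sq hT hw, h.norm_sq_starProjection hT hw, mul_add]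
  have : C ^ 2 ≤ 1 := pow_le_one₀ hC hC1
  nlinarith [sq_nonneg ⟪v₁, w⟫]

/-- A vector of `T` whose length is preserved by the projection to `P` is a multiple of `v₁`. -/
theorem IsPrincipalBasis.eq_smul_of_norm_starProjection (hT : Module.finrank ℝ T = 2)
    (hC : 0 ≤ C) (hC1 : C < 1) (h : IsPrincipalBasis T P C v₁ v₂) {w : E4} (hw : w ∈ T)
    (hPw : ‖P.starProjection w‖ = ‖w‖) : w = ⟪v₁, w⟫ • v₁ := by
  have h1 : ⟪v₂, w⟫ = 0 := by
    have h2 := h.norm_sq_starProjection hT hw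
    rw [hPw, h.norm_sq hT hw] at h2
    have h3 : (1 - C ^ 2) * ⟪v₂, w⟫ ^ 2 = 0 := by linarith
    have h4 : 1 - C ^ 2 ≠ 0 := by nlinarith
    simpa [h4] using h3
  have h2 := Submodule.eq_inner_smul_add_inner_smul hT h.mem₁ h.mem₂ h.norm₁ h.norm₂ h.inner_eq hw
  rwa [h1, zero_smul, add_zero] at h2

theorem IsPrincipalBasis.eq_of_one (hT : Module.finrank ℝ T = 2) (hP : Module.finrank ℝ P = 2)
    (h : IsPrincipalBasis T P 1 v₁ v₂) : T = P := by
  have h2 : v₂ ∈ P := by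
    have h3 := norm_sq_starProjection_add P v₂
    rw [h.norm_proj, h.norm₂] at h3
    have h4 : Pᗮ.starProjection v₂ = 0 := by
      rw [← norm_eq_zero]
      nlinarith
    have h5 := (Submodule.starProjection_apply_eq_zero_iff _).mp h4
    rwa [Submodule.orthogonal_orthogonal] at h5
  refine Submodule.eq_of_le_of_finrank_eq (fun w hw => ?_) (hT.trans hP.symm)
  rw [Submodule.eq_inner_smul_add_inner_smul hT h.mem₁ h.mem₂ h.norm₁ h.norm₂ h.inner_eq hw]
  exact P.add_mem (P.smul_mem _ h.mem_plane) (P.smul_mem _ h2)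

end PrincipalBasis

section Ambient

variable {M : Type*} [TopologicalSpace M] [ChartedSpace (EuclideanSpace ℝ (Fin 2)) M]

/-- The derivative of a map with values in a subspace has values in this subspace. -/
theorem mfderiv_apply_mem {K : Submodule ℝ E4} {F : M → E4} {p : M} (hF : ∀ᶠ q in 𝓝 p, F q ∈ K)
    (X : TangentSpace (𝓡 2) p) : (mfderiv (𝓡 2) 𝓘(ℝ, E4) F p X : E4) ∈ K := by
  by_cases hd : MDifferentiableAt (𝓡 2) 𝓘(ℝ, E4) F p
  · have h1 : MDifferentiableAt 𝓘(ℝ, E4) 𝓘(ℝ, E4) Kᗮ.starProjection (F p) :=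
      Kᗮ.starProjection.differentiableAt.mdifferentiableAt
    have h2 := mfderiv_comp p h1 hd
    have h3 : Kᗮ.starProjection ∘ F =ᶠ[𝓝 p] fun _ => 0 := by
      filter_upwards [hF] with q hq using Submodule.starProjection_orthogonal_apply_eq_zero hq
    rw [h3.mfderiv_eq, mfderiv_const, mfderiv_eq_fderiv, Kᗮ.starProjection.fderiv] at h2
    have h4 : Kᗮ.starProjection (mfderiv (𝓡 2) 𝓘(ℝ, E4) F p X : E4) = 0 :=
      (congrArg (fun A => A X) h2).symm
    have h5 := (Submodule.starProjection_apply_eq_zero_iff _).mp h4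
    rwa [Submodule.orthogonal_orthogonal] at h5
  -- The default value `0` of the derivative also lies in `K`.
  · rw [mfderiv_zero_of_not_mdifferentiableAt hd]
    exact K.zero_mem

theorem ambientDeriv_mem {K : Submodule ℝ E4} {f : M → E4} {U : Set M}
    {T : ∀ p : M, TangentSpace (𝓡 2) p} (hU : IsOpen U) (hT : ∀ q ∈ U, surfDiff f q (T q) ∈ K)
    {p : M} (hp : p ∈ U) (X : TangentSpace (𝓡 2) p) : ambientDeriv f T p X ∈ K :=
  mfderiv_apply_mem (by filter_upwards [hU.mem_nhds hp] with q hq using hT q hq) X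

theorem isTotallyGeodesic_of_tangentPlane_eq [IsManifold (𝓡 2) ∞ M] {f : M → E4}
    {P : Submodule ℝ E4} (h : ∀ p, tangentPlane f p = P) : IsTotallyGeodesic f := by
  intro U T hU _ p hp X
  refine Submodule.starProjection_orthogonal_apply_eq_zero ?_
  rw [h p]
  exact ambientDeriv_mem hU (fun q _ => h q ▸ ⟨T q, rfl⟩) hp X

end Ambient

end
noncomputable section

/-! ### Surfaces whose tangent planes meet a fixed plane in lines -/

section CommonLine

open Metric Set

variable {M : Type*} [TopologicalSpace M] [ChartedSpace (EuclideanSpace ℝ (Fin 2)) M]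
  {f : M → E4} {P : Submodule ℝ E4} {C : ℝ} {σ : P → M} {c : P}

/-- Near `x`, the map `σ` is a smooth section of the projection of the surface to `P`. -/
def IsSectionAt (f : M → E4) (P : Submodule ℝ E4) (c : P) (σ : P → M) (x : P) : Prop :=
  ContMDiffAt 𝓘(ℝ, P) (𝓡 2) ∞ σ x ∧ ∀ᶠ y in 𝓝 x, P.orthogonalProjectionOnto (f (σ y)) = c + y

theorem IsSectionAt.congr {σ' : P → M} {x : P} (h : σ =ᶠ[𝓝 x] σ') (hσ : IsSectionAt f P c σ x) :
    IsSectionAt f P c σ' x := by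
  refine ⟨hσ.1.congr_of_eventuallyEq h.symm, ?_⟩
  filter_upwards [hσ.2, h] with y hy h1
  rwa [← h1]

theorem IsSectionAt.contDiffAt (hf : ContMDiff (𝓡 2) 𝓘(ℝ, E4) ∞ f) {x : P}
    (hσ : IsSectionAt f P c σ x) : ContDiffAt ℝ ∞ (f ∘ σ) x :=
  contMDiffAt_iff_contDiffAt.mp ((hf (σ x)).comp x hσ.1)

theorem IsSectionAt.fderiv_mem (hf : ContMDiff (𝓡 2) 𝓘(ℝ, E4) ∞ f) {x : P}
    (hσ : IsSectionAt f P c σ x) (a : P) : fderiv ℝ (f ∘ σ) x a ∈ tangentPlane f (σ x) :=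
  fderiv_comp_mem_tangentPlane hf (hσ.1.mdifferentiableAt (by simp)) a

theorem IsSectionAt.starProjection_fderiv (hf : ContMDiff (𝓡 2) 𝓘(ℝ, E4) ∞ f) {x : P}
    (hσ : IsSectionAt f P c σ x) (a : P) : P.starProjection (fderiv ℝ (f ∘ σ) x a) = a := by
  have h1 := P.orthogonalProjectionOnto.hasFDerivAt.comp x
    ((hσ.contDiffAt hf).differentiableAt (by simp)).hasFDerivAt
  have h2 : (P.orthogonalProjectionOnto ∘ (f ∘ σ)) =ᶠ[𝓝 x] fun y => c + y := hσ.2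
  have h3 := (h1.congr_of_eventuallyEq h2.symm).unique ((hasFDerivAt_id x).const_add c)
  exact congrArg Subtype.val (congrArg (fun A => A a) h3)

theorem isSectionAt_chart_symm {e : OpenPartialHomeomorph M P}
    (he : ∀ x ∈ e.source, e x = P.orthogonalProjectionOnto (f x))
    (hsymm : ContMDiffOn 𝓘(ℝ, P) (𝓡 2) ∞ e.symm e.target) {x : P} (hx : c + x ∈ e.target) :
    IsSectionAt f P c (fun y => e.symm (c + y)) x := by
  have hc : ContDiff ℝ ∞ fun y : P => c + y := contDiff_const.add contDiff_id
  refine ⟨(hsymm.contMDiffAt (e.open_target.mem_nhds hx)).comp x hc.contDiffAt.contMDiffAt, ?_⟩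
  filter_upwards [hc.continuous.continuousAt.eventually (e.open_target.mem_nhds hx)] with y hy
  rw [← he _ (e.map_target hy), e.right_inv hy]

variable [IsManifold (𝓡 2) ∞ M]

theorem exists_chart_of_isPrincipalBasis (hf : Manifold.IsImmersion (𝓡 2) 𝓘(ℝ, E4) ∞ f)
    (hP : Module.finrank ℝ P = 2) (hC : 0 < C) (hC1 : C < 1)
    (hbasis : ∀ p, ∃ v₁ v₂, IsPrincipalBasis (tangentPlane f p) P C v₁ v₂) (q : M) :
    ∃ e : OpenPartialHomeomorph M P, q ∈ e.source ∧
      (∀ x ∈ e.source, e x = P.orthogonalProjectionOnto (f x)) ∧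
      ContMDiffOn 𝓘(ℝ, P) (𝓡 2) ∞ e.symm e.target ∧
      ∃ r > 0, e.target = ball (P.orthogonalProjectionOnto (f q)) r := by
  refine exists_chart_of_injOn_tangentPlane hP hf P.orthogonalProjectionOnto q fun w hw h => ?_
  obtain ⟨v₁, v₂, hv⟩ := hbasis q
  have h1 := hv.le_norm_starProjection (finrank_tangentPlane hf q) hC.le hC1.le hw
  rw [Submodule.starProjection_apply, h, Submodule.coe_zero, norm_zero] at h1
  rw [← norm_eq_zero]
  nlinarith [norm_nonneg w]

/-- Along a global section, the vectors of `P` that are tangent to the surface are constant. -/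
theorem mem_tangentPlane_of_isSectionAt (hf : Manifold.IsImmersion (𝓡 2) 𝓘(ℝ, E4) ∞ f)
    (hP : Module.finrank ℝ P = 2) (hC : 0 < C) (hC1 : C < 1)
    (hbasis : ∀ p, ∃ v₁ v₂, IsPrincipalBasis (tangentPlane f p) P C v₁ v₂)
    (hσ : ∀ x, IsSectionAt f P c σ x) {v : E4} (hv : v ∈ P) {y y' : P}
    (hy : v ∈ tangentPlane f (σ y)) : v ∈ tangentPlane f (σ y') := by
  have hsm : ContDiff ℝ ∞ (f ∘ σ) :=
    contDiff_iff_contDiffAt.mpr fun x => (hσ x).contDiffAt hf.contMDiff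
  have hu : ContDiff ℝ ∞ (Pᗮ.starProjection ∘ f ∘ σ) := Pᗮ.starProjection.contDiff.comp hsm
  have hd : ∀ y a, fderiv ℝ (Pᗮ.starProjection ∘ f ∘ σ) y a =
      Pᗮ.starProjection (fderiv ℝ (f ∘ σ) y a) := fun y a => by
    rw [(Pᗮ.starProjection.hasFDerivAt.comp y
      (hsm.differentiable (by simp) y).hasFDerivAt).fderiv]
    rfl
  have hs : 0 < 1 - C ^ 2 := by nlinarith
  -- Each `a ∈ P` is `p_P w` for the tangent vector `w = d(f ∘ σ) a`, whose `Pᗮ` part is `⟪v₂, w⟫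
  -- p_{Pᗮ} v₂`, while `⟪p_P v₂, a⟫ = C² ⟪v₂, w⟫`. Normalizing `p_P v₂` and `p_{Pᗮ} v₂`, of lengths
  -- `C` and `√(1 - C²)`, produces the constant `√(1 - C²) / C`.
  have hrank : ∀ y, ∃ (e : P) (n : E4), ‖e‖ = 1 ∧ ‖n‖ = 1 ∧
      ∀ a, fderiv ℝ (Pᗮ.starProjection ∘ f ∘ σ) y a = (√(1 - C ^ 2) / C * ⟪e, a⟫) • n := by
    intro y
    obtain ⟨v₁, v₂, hb⟩ := hbasis (σ y)
    have hn : ‖Pᗮ.starProjection v₂‖ = √(1 - C ^ 2) := by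
      have h1 := norm_sq_starProjection_add P v₂
      rw [hb.norm_proj, hb.norm₂] at h1
      rw [eq_comm, Real.sqrt_eq_iff_eq_sq hs.le (norm_nonneg _)]
      linarith
    refine ⟨C⁻¹ • ⟨P.starProjection v₂, P.starProjection_apply_mem _⟩,
      (√(1 - C ^ 2))⁻¹ • Pᗮ.starProjection v₂, ?_, ?_, fun a => ?_⟩
    · rw [norm_smul, norm_inv, Real.norm_of_nonneg hC.le, Submodule.coe_norm]
      exact hb.norm_proj ▸ inv_mul_cancel₀ (hb.norm_proj ▸ hC.ne')
    · rw [norm_smul, norm_inv, Real.norm_of_nonneg (Real.sqrt_nonneg _), hn,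
        inv_mul_cancel₀ (Real.sqrt_pos.mpr hs).ne']
    · have hw := (hσ y).fderiv_mem hf.contMDiff a
      have ha := (hσ y).starProjection_fderiv hf.contMDiff a
      rw [hd]
      generalize fderiv ℝ (f ∘ σ) y a = w at hw ha
      have hT := finrank_tangentPlane hf (σ y)
      have h1 : ⟪P.starProjection v₂, (a : E4)⟫ = C ^ 2 * ⟪v₂, w⟫ := by
        rw [← ha, hb.inner_starProjection_starProjection hT hw]
      have h2 : Pᗮ.starProjection w = ⟪v₂, w⟫ • Pᗮ.starProjection v₂ := by
        conv_lhs => rw [Submodule.eq_inner_smul_add_inner_smul hT hb.mem₁ hb.mem₂ hb.norm₁ hb.norm₂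
          hb.inner_eq hw, map_add, map_smul, map_smul,
          Submodule.starProjection_orthogonal_apply_eq_zero hb.mem_plane, smul_zero, zero_add]
      have h3 : √(1 - C ^ 2) ≠ 0 := (Real.sqrt_pos.mpr hs).ne'
      have h4 : ⟪C⁻¹ • (⟨P.starProjection v₂, P.starProjection_apply_mem _⟩ : P), a⟫ =
          C⁻¹ * (C ^ 2 * ⟪v₂, w⟫) := by
        rw [← h1]
        exact real_inner_smul_left (P.starProjection v₂) (a : E4) C⁻¹
      rw [h2, smul_smul, h4]
      congr 1
      field_simp
  have hinj : ∀ y, ∀ w ∈ tangentPlane f (σ y), P.starProjection w = v → v ∈ tangentPlane f (σ y) →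
      w = v := by
    intro y w hw hwv hvT
    obtain ⟨v₁, v₂, hb⟩ := hbasis (σ y)
    have h1 := hb.le_norm_starProjection (finrank_tangentPlane hf _) hC.le hC1.le
      (Submodule.sub_mem _ hw hvT)
    rw [map_sub, hwv, P.starProjection_eq_self_iff.mpr hv, sub_self, norm_zero] at h1
    rw [← sub_eq_zero, ← norm_eq_zero]
    nlinarith [norm_nonneg (w - v)]
  -- A vector of `P` tangent to the surface is its own lift, so it lies in the kernel of the `Pᗮ`
  -- part; the kernel being constant, its lift at `y'` is again `v`.
  have h1 : fderiv ℝ (f ∘ σ) y ⟨v, hv⟩ = v :=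
    hinj y _ ((hσ y).fderiv_mem hf.contMDiff _) ((hσ y).starProjection_fderiv hf.contMDiff _) hy
  have h2 := fderiv_apply_eq_zero_of_rankOne hP (hu.of_le ENat.LEInfty.out)
    (div_pos (Real.sqrt_pos.mpr hs) hC) hrank (x := y) (a := ⟨v, hv⟩)
    (by rw [hd, h1, Submodule.starProjection_orthogonal_apply_eq_zero hv]) y'
  have h3 := P.starProjection_add_starProjection_orthogonal (fderiv ℝ (f ∘ σ) y' ⟨v, hv⟩)
  rw [← hd, h2, add_zero, (hσ y').starProjection_fderiv hf.contMDiff] at h3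
  rw [show v = fderiv ℝ (f ∘ σ) y' ⟨v, hv⟩ from h3]
  exact (hσ y').fderiv_mem hf.contMDiff _

variable [T2Space M]

/-- On a complete surface, the projection to `P` has global sections. -/
theorem exists_global_section (hf : Manifold.IsImmersion (𝓡 2) 𝓘(ℝ, E4) ∞ f)
    (hcomplete : IsCompleteSurface f) (hP : Module.finrank ℝ P = 2) (hC : 0 < C) (hC1 : C < 1)
    (hbasis : ∀ p, ∃ v₁ v₂, IsPrincipalBasis (tangentPlane f p) P C v₁ v₂) (p : M) :
    ∃ (c : P) (σ : P → M), (∀ x, IsSectionAt f P c σ x) ∧ range σ ∈ 𝓝 p := by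
  obtain ⟨e₀, hp, he₀, hsymm₀, r₀, hr₀, htarget₀⟩ :=
    exists_chart_of_isPrincipalBasis hf hP hC hC1 hbasis p
  let c := P.orthogonalProjectionOnto (f p)
  have huniq : ∀ g g' x, IsSectionAt f P c g x → IsSectionAt f P c g' x →
      (∃ᶠ y in 𝓝 x, g =ᶠ[𝓝 y] g') → g =ᶠ[𝓝 x] g' := by
    intro g g' x hg hg' h
    have h1 : g x = g' x := tendsto_nhds_unique_of_frequently_eq hg.1.continuousAt
      hg'.1.continuousAt (h.mono fun y hy => hy.self_of_nhds)
    obtain ⟨e, hq, he, -⟩ := exists_chart_of_isPrincipalBasis hf hP hC hC1 hbasis (g x)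
    filter_upwards [hg.2, hg'.2, hg.1.continuousAt.eventually (e.open_source.mem_nhds hq),
      hg'.1.continuousAt.eventually (e.open_source.mem_nhds (h1 ▸ hq))] with y h2 h3 h4 h5
    refine e.injOn h4 h5 ?_
    rw [he _ h4, he _ h5, h2, h3]
  obtain ⟨σ, hσ, hσ0⟩ := exists_global_continuation (Q := IsSectionAt f P c)
    (fun g g' x h hg => hg.congr h) huniq
    (fun g z hg => by
      let γ : ℝ → M := fun τ => g (τ • z)
      have hline : ContDiff ℝ ∞ fun τ : ℝ => τ • z := contDiff_id.smul contDiff_const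
      have hγ : ∀ t ∈ Ico (0 : ℝ) 1, ContMDiffAt 𝓘(ℝ, ℝ) (𝓡 2) ∞ γ t := fun t ht =>
        (hg t ht).1.comp t hline.contDiffAt.contMDiffAt
      obtain ⟨q, hq⟩ := hcomplete.exists_tendsto (K := ‖z‖ / C) hf.contMDiff hγ
        (fun t ht => by
          have h1 : HasDerivAt (fun τ : ℝ => τ • z) z t := by
            simpa using (hasDerivAt_id t).smul_const z
          have h2 : HasDerivAt ((f ∘ g) ∘ fun τ : ℝ => τ • z) _ t :=
            (((hg t ht).contDiffAt hf.contMDiff).differentiableAt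
              (by simp)).hasFDerivAt.comp_hasDerivAt t h1
          have h3 : fderiv ℝ (f ∘ γ) t 1 = fderiv ℝ (f ∘ g) (t • z) z := by
            rw [fderiv_apply_one_eq_deriv]; exact h2.deriv
          obtain ⟨v₁, v₂, hv⟩ := hbasis (g (t • z))
          have h4 := hv.le_norm_starProjection (finrank_tangentPlane hf _) hC.le hC1.le
            ((hg t ht).fderiv_mem hf.contMDiff z)
          rw [(hg t ht).starProjection_fderiv hf.contMDiff] at h4
          rw [h3, le_div_iff₀ hC, mul_comm]
          exact h4)
      obtain ⟨e, hqe, he, hsymm, r, hr, htarget⟩ :=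
        exists_chart_of_isPrincipalBasis hf hP hC hC1 hbasis q
      have hev1 : ∀ᶠ m in 𝓝 q, m ∈ e.source ∧ dist (e m) (e q) < r / 2 :=
        Filter.Eventually.and (e.open_source.mem_nhds hqe)
          ((e.continuousAt hqe).eventually (ball_mem_nhds _ (half_pos hr)))
      have hev2 : ∀ᶠ τ : ℝ in 𝓝[<] 1, ‖z - τ • z‖ < r / 2 := by
        have h1 : ContinuousAt (fun τ : ℝ => ‖z - τ • z‖) 1 := by fun_prop
        refine nhdsWithin_le_nhds (h1.eventually (gt_mem_nhds ?_))
        simp only [one_smul, sub_self, norm_zero]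
        linarith
      have hev3 : ∀ᶠ τ : ℝ in 𝓝[<] 1, τ ∈ Ico (0 : ℝ) 1 :=
        Ico_mem_nhdsLT zero_lt_one
      obtain ⟨τ, ⟨hτ1, hτ2⟩, hτ3, hτ⟩ := ((hq.eventually hev1).and (hev2.and hev3)).exists
      have hτ4 : dist (c + τ • z) (e q) < r / 2 := by
        rwa [he _ hτ1, (hg τ hτ).2.self_of_nhds] at hτ2
      refine ⟨τ, hτ, fun y => e.symm (c + y), r / 2, hτ3, ?_, ?_⟩
      · intro x hx
        refine isSectionAt_chart_symm he hsymm ?_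
        rw [htarget, ← he q hqe]
        have h1 : dist (c + x) (c + τ • z) < r / 2 := by rwa [dist_add_left]
        exact (dist_triangle _ _ _).trans_lt ((add_lt_add h1 hτ4).trans_eq (add_halves r))
      · filter_upwards [(hg τ hτ).1.continuousAt.eventually (e.open_source.mem_nhds hτ1),
          (hg τ hτ).2] with y hy hy2
        rw [← hy2, ← he _ hy, e.left_inv hy])
    hr₀ (g₀ := fun y => e₀.symm (c + y)) (fun x hx => isSectionAt_chart_symm he₀ hsymm₀ (by
      rw [htarget₀, mem_ball_iff_norm, add_sub_cancel_left]
      exact mem_ball_zero_iff.mp hx))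
  refine ⟨c, σ, hσ, ?_⟩
  have h1 : Filter.Tendsto (fun m => e₀ m - c) (𝓝 p) (𝓝 0) := by
    have h2 := (e₀.continuousAt hp).tendsto.sub_const c
    rwa [he₀ p hp, sub_self] at h2
  filter_upwards [h1.eventually hσ0, e₀.open_source.mem_nhds hp] with m hm hm2
  exact ⟨_, hm.trans (by rw [add_sub_cancel, e₀.left_inv hm2])⟩

/-- The images of global sections are neighbourhoods on which tangency of `v` holds everywhere or
nowhere, so it is a clopen condition on the connected surface. -/
theorem mem_tangentPlane_of_mem_tangentPlane [ConnectedSpace M]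
    (hf : Manifold.IsImmersion (𝓡 2) 𝓘(ℝ, E4) ∞ f)
    (hcomplete : IsCompleteSurface f) (hP : Module.finrank ℝ P = 2) (hC : 0 < C) (hC1 : C < 1)
    (hbasis : ∀ p, ∃ v₁ v₂, IsPrincipalBasis (tangentPlane f p) P C v₁ v₂) {v : E4} (hv : v ∈ P)
    {p q : M} (hp : v ∈ tangentPlane f p) : v ∈ tangentPlane f q := by
  have key : ∀ q, ∃ U ∈ 𝓝 q, (U ∩ {q | v ∈ tangentPlane f q}).Nonempty →
      U ⊆ {q | v ∈ tangentPlane f q} := by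
    intro q
    obtain ⟨c, σ, hσ, hr⟩ := exists_global_section hf hcomplete hP hC hC1 hbasis q
    refine ⟨range σ, hr, ?_⟩
    rintro ⟨_, ⟨y, rfl⟩, hy⟩ _ ⟨y', rfl⟩
    exact mem_tangentPlane_of_isSectionAt hf hP hC hC1 hbasis hσ hv hy
  have hclopen : IsClopen {q | v ∈ tangentPlane f q} := by
    constructor
    · refine isClosed_iff_nhds.mpr fun q hq => ?_
      obtain ⟨U, hU, h⟩ := key q
      exact h (hq U hU) (mem_of_mem_nhds hU)
    · refine isOpen_iff_mem_nhds.mpr fun q hq => ?_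
      obtain ⟨U, hU, h⟩ := key q
      exact Filter.mem_of_superset hU (h ⟨q, mem_of_mem_nhds hU, hq⟩)
  exact (hclopen.eq_univ ⟨p, hp⟩).ge (mem_univ q)

/-- The principal directions of a complete surface lie in two fixed orthogonal subspaces. -/
theorem exists_splitting [ConnectedSpace M] (hf : Manifold.IsImmersion (𝓡 2) 𝓘(ℝ, E4) ∞ f)
    (hcomplete : IsCompleteSurface f) (hP : Module.finrank ℝ P = 2) (hC : 0 ≤ C) (hC1 : C < 1)
    (hbasis : ∀ p, ∃ v₁ v₂, IsPrincipalBasis (tangentPlane f p) P C v₁ v₂) :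
    ∃ V : Submodule ℝ E4, ∀ p, ∃ v₁ v₂, IsPrincipalBasis (tangentPlane f p) P C v₁ v₂ ∧
      v₁ ∈ V ∧ v₂ ∈ Vᗮ := by
  -- For `C = 0` the direction `v₁` may turn inside `P`, but `v₂ ⟂ P`, so `V = P` serves. For `C >
  -- 0` the line of `v₁` is the same at all points and spans `V`.
  rcases hC.eq_or_lt with rfl | hC
  · refine ⟨P, fun p => ?_⟩
    obtain ⟨v₁, v₂, h⟩ := hbasis p
    exact ⟨v₁, v₂, h, h.mem_plane,
      (Submodule.starProjection_apply_eq_zero_iff _).mp (norm_eq_zero.mp h.norm_proj)⟩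
  obtain ⟨v, v', hv⟩ := hbasis (Classical.arbitrary M)
  refine ⟨ℝ ∙ v, fun p => ?_⟩
  obtain ⟨v₁, v₂, h⟩ := hbasis p
  have h1 : v ∈ tangentPlane f p :=
    mem_tangentPlane_of_mem_tangentPlane hf hcomplete hP hC hC1 hbasis hv.mem_plane hv.mem₁
  have h2 := h.eq_smul_of_norm_starProjection (finrank_tangentPlane hf p) hC.le hC1 h1
    (by rw [P.starProjection_eq_self_iff.mpr hv.mem_plane])
  have h3 : ⟪v, v₂⟫ = 0 := by
    rw [h2, real_inner_smul_left, h.inner_eq, mul_zero]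
  exact ⟨v, v₂, ⟨h1, hv.mem_plane, h.mem₂, hv.norm₁, h.norm₂, h3, h.norm_proj⟩,
    Submodule.mem_span_singleton_self v,
    (Submodule.mem_orthogonal_singleton_iff_inner_right).mpr h3⟩

end CommonLine

end
noncomputable section

/-! ### Principal frames -/

section Frames

open Set

variable {M : Type*} [TopologicalSpace M] [ChartedSpace (EuclideanSpace ℝ (Fin 2)) M]
  {f : M → E4} {P V : Submodule ℝ E4} {θ : ℝ}

/-- The derivative of a map of constant length is orthogonal to the map. -/
theorem inner_mfderiv_eq_zero {F : M → E4} {p : M} (hF : ∀ᶠ q in 𝓝 p, ‖F q‖ = 1)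
    (X : TangentSpace (𝓡 2) p) : ⟪F p, (mfderiv (𝓡 2) 𝓘(ℝ, E4) F p X : E4)⟫ = 0 := by
  by_cases hd : MDifferentiableAt (𝓡 2) 𝓘(ℝ, E4) F p
  · have h0 := (hasStrictFDerivAt_norm_sq (F p)).hasFDerivAt
    have h1 : MDifferentiableAt 𝓘(ℝ, E4) 𝓘(ℝ, ℝ) (fun z : E4 => ‖z‖ ^ 2) (F p) :=
      h0.differentiableAt.mdifferentiableAt
    have h2 := mfderiv_comp p h1 hd
    have h3 : (fun z : E4 => ‖z‖ ^ 2) ∘ F =ᶠ[𝓝 p] fun _ => 1 := by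
      filter_upwards [hF] with q hq
      simp [hq]
    rw [h3.mfderiv_eq, mfderiv_const, mfderiv_eq_fderiv, h0.fderiv] at h2
    have h4 : (2 : ℕ) • ⟪F p, (mfderiv (𝓡 2) 𝓘(ℝ, E4) F p X : E4)⟫ = 0 :=
      (congrArg (fun A => A X) h2).symm
    simpa using h4
  · rw [mfderiv_zero_of_not_mdifferentiableAt hd]
    exact inner_zero_right _

/-- The coordinate field in the direction `a` of a chart with values in the plane. -/
def coordField (e : OpenPartialHomeomorph M (ℝ × ℝ)) (a : ℝ × ℝ) (q : M) : TangentSpace (𝓡 2) q :=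
  (mfderiv 𝓘(ℝ, ℝ × ℝ) (𝓡 2) e.symm (e q) a : EuclideanSpace ℝ (Fin 2))

theorem IsProductChart.surfDiff_coordField (hf : ContMDiff (𝓡 2) 𝓘(ℝ, E4) ∞ f)
    {e : OpenPartialHomeomorph M (ℝ × ℝ)} (he : IsProductChart f V e) (a : ℝ × ℝ) {q : M}
    (hq : q ∈ e.source) :
    surfDiff f q (coordField e a q) = fderiv ℝ (f ∘ e.symm) (e q) a := by
  have h1 := fderiv_comp_surface hf
    ((he.isProductAt (e.map_source hq)).1.mdifferentiableAt (by simp)) a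
  -- The base point `e.symm (e q)` is `q` only propositionally; the vector is transported as an
  -- element of the common model space.
  have h2 : ∀ (q' : M) (v : EuclideanSpace ℝ (Fin 2)), q' = q →
      surfDiff f q' v = surfDiff f q v := by
    rintro q' v rfl
    rfl
  rw [h1]
  exact (h2 _ _ (e.left_inv hq)).symm

variable [IsManifold (𝓡 2) ∞ M] {U : Set M} {T₁ T₂ : ∀ q : M, TangentSpace (𝓡 2) q}

theorem IsPrincipalFrame.norm_eq_one_and_inner_eq_zero {θ₁ θ₂ : ℝ}
    (h : IsPrincipalFrame f P θ₁ θ₂ U T₁ T₂)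
    {q : M} (hq : q ∈ U) :
    ‖surfDiff f q (T₁ q)‖ = 1 ∧ ‖surfDiff f q (T₂ q)‖ = 1 ∧
      ⟪surfDiff f q (T₁ q), surfDiff f q (T₂ q)⟫ = 0 := by
  have ho := h.orthonormal q hq
  exact ⟨ho.1 0, ho.1 1, ho.2 (i := 0) (j := 1) (by decide)⟩

/-- The fields of a principal frame lie in the two subspaces of the splitting. -/
theorem IsPrincipalFrame.mem_splitting (hf : Manifold.IsImmersion (𝓡 2) 𝓘(ℝ, E4) ∞ f)
    (hC : 0 ≤ Real.cos θ) (hC1 : Real.cos θ < 1)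
    (hV : ∀ p, ∃ v₁ v₂, IsPrincipalBasis (tangentPlane f p) P (Real.cos θ) v₁ v₂ ∧
      v₁ ∈ V ∧ v₂ ∈ Vᗮ) (h : IsPrincipalFrame f P 0 θ U T₁ T₂) {q : M} (hq : q ∈ U) :
    surfDiff f q (T₁ q) ∈ V ∧ surfDiff f q (T₂ q) ∈ Vᗮ := by
  obtain ⟨v₁, v₂, hb, hv₁, hv₂⟩ := hV q
  obtain ⟨h1, h2, h3⟩ := h.norm_eq_one_and_inner_eq_zero hq
  have hT := finrank_tangentPlane hf q
  have hm₁ : surfDiff f q (T₁ q) ∈ tangentPlane f q := ⟨_, rfl⟩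
  have hm₂ : surfDiff f q (T₂ q) ∈ tangentPlane f q := ⟨_, rfl⟩
  -- Eigenvalue `1` means that the projection to `P` preserves the length of `T₁`; as `C < 1`, this
  -- makes `T₁` a multiple of `v₁`. Then `T₂`, orthogonal to it, is a multiple of `v₂`.
  have h4 : ‖P.starProjection (surfDiff f q (T₁ q))‖ = ‖surfDiff f q (T₁ q)‖ := by
    have h5 := inner_principalOperator P (tangentPlane f q) (toTangentPlane f q (T₁ q))
      (toTangentPlane f q (T₁ q))
    rw [h.eigen₁ q hq, Real.cos_zero, one_pow, one_smul, real_inner_self_eq_norm_sq,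
      real_inner_self_eq_norm_sq] at h5
    exact ((pow_left_inj₀ (norm_nonneg _) (norm_nonneg _) two_ne_zero).mp h5).symm
  have h5 := hb.eq_smul_of_norm_starProjection hT hC hC1 hm₁ h4
  refine ⟨h5 ▸ V.smul_mem _ hv₁, ?_⟩
  have h6 : ⟪v₁, surfDiff f q (T₁ q)⟫ ≠ 0 := fun h0 => by
    rw [h0, zero_smul] at h5
    rw [h5, norm_zero] at h1
    exact zero_ne_one h1
  rw [h5, real_inner_smul_left] at h3
  have h7 := (mul_eq_zero.mp h3).resolve_left h6
  rw [Submodule.eq_inner_smul_add_inner_smul hT hb.mem₁ hb.mem₂ hb.norm₁ hb.norm₂ hb.inner_eq hm₂,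
    h7, zero_smul, zero_add]
  exact Vᗮ.smul_mem _ hv₂

theorem leviCivita_eq_zero (hf : Manifold.IsImmersion (𝓡 2) 𝓘(ℝ, E4) ∞ f) {q : M} {w₁ w₂ : E4}
    (hw₁ : w₁ ∈ tangentPlane f q) (hw₂ : w₂ ∈ tangentPlane f q) (h1 : ‖w₁‖ = 1) (h2 : ‖w₂‖ = 1)
    (h3 : ⟪w₁, w₂⟫ = 0) {T : ∀ q : M, TangentSpace (𝓡 2) q} {X : TangentSpace (𝓡 2) q}
    (h4 : ⟪w₁, ambientDeriv f T q X⟫ = 0) (h5 : ⟪w₂, ambientDeriv f T q X⟫ = 0) :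
    leviCivita f T q X = 0 := by
  refine (Submodule.starProjection_apply_eq_zero_iff _).mpr fun w hw => ?_
  rw [Submodule.eq_inner_smul_add_inner_smul (finrank_tangentPlane hf q) hw₁ hw₂ h1 h2 h3 hw,
    inner_add_left, real_inner_smul_left, real_inner_smul_left, h4, h5, mul_zero, mul_zero,
    add_zero]

/-- Each field has constant length, which kills the component of its derivative along itself, and
stays in `V` or `Vᗮ`, which kills the component along the other field. -/
theorem IsPrincipalFrame.isParallelOn (hf : Manifold.IsImmersion (𝓡 2) 𝓘(ℝ, E4) ∞ f)
    (hC : 0 ≤ Real.cos θ) (hC1 : Real.cos θ < 1)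
    (hV : ∀ p, ∃ v₁ v₂, IsPrincipalBasis (tangentPlane f p) P (Real.cos θ) v₁ v₂ ∧
      v₁ ∈ V ∧ v₂ ∈ Vᗮ) (hU : IsOpen U) (h : IsPrincipalFrame f P 0 θ U T₁ T₂) :
    IsParallelOn f U T₁ ∧ IsParallelOn f U T₂ := by
  have hmem := fun q hq => h.mem_splitting hf hC hC1 hV (q := q) hq
  constructor
  · intro q hq X
    obtain ⟨h1, h2, h3⟩ := h.norm_eq_one_and_inner_eq_zero hq
    refine leviCivita_eq_zero hf ⟨_, rfl⟩ ⟨_, rfl⟩ h1 h2 h3 ?_ ?_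
    · refine inner_mfderiv_eq_zero (F := fun q => surfDiff f q (T₁ q)) ?_ X
      filter_upwards [hU.mem_nhds hq] with z hz using (h.norm_eq_one_and_inner_eq_zero hz).1
    · rw [real_inner_comm]
      exact (hmem q hq).2 _ (ambientDeriv_mem hU (fun z hz => (hmem z hz).1) hq X)
  · intro q hq X
    obtain ⟨h1, h2, h3⟩ := h.norm_eq_one_and_inner_eq_zero hq
    refine leviCivita_eq_zero hf ⟨_, rfl⟩ ⟨_, rfl⟩ h1 h2 h3 ?_ ?_
    · exact ambientDeriv_mem hU (fun z hz => (hmem z hz).2) hq X _ (hmem q hq).1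
    · refine inner_mfderiv_eq_zero (F := fun q => surfDiff f q (T₂ q)) ?_ X
      filter_upwards [hU.mem_nhds hq] with z hz using (h.norm_eq_one_and_inner_eq_zero hz).2.1

theorem IsProductChart.isSmoothField {e : OpenPartialHomeomorph M (ℝ × ℝ)}
    (he : IsProductChart f V e) (a : ℝ × ℝ) : IsSmoothField e.source (coordField e a) := by
  have h1 : ContMDiff 𝓘(ℝ, ℝ × ℝ) 𝓘(ℝ, ℝ × ℝ).tangent ∞
      (fun z : ℝ × ℝ => (⟨z, a⟩ : TangentBundle 𝓘(ℝ, ℝ × ℝ) (ℝ × ℝ))) :=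
    contMDiff_vectorSpace_iff_contDiff.mpr contDiff_const
  have h2 := he.smooth_symm.contMDiffOn_tangentMapWithin (m := ∞) (by simp)
    e.open_target.uniqueMDiffOn
  have h3 := h2.comp (h1.comp_contMDiffOn he.smooth) (fun q hq => e.map_source hq)
  refine h3.congr fun q hq => ?_
  simp only [Function.comp_apply, tangentMapWithin]
  rw [mfderivWithin_of_isOpen e.open_target (e.map_source hq)]
  have h4 : ∀ (q' : M) (v : EuclideanSpace ℝ (Fin 2)), q' = q →
      (⟨q', v⟩ : TangentBundle (𝓡 2) M) = ⟨q, v⟩ := by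
    rintro q' v rfl
    rfl
  exact (h4 _ _ (e.left_inv hq)).symm

/-- A tangent vector in `V` is a multiple of `v₁ ∈ P`, and one in `Vᗮ` is a multiple of `v₂`; these
are eigenvectors with eigenvalues `1` and `cos² θ`. -/
theorem IsProductChart.isPrincipalFrame (hf : Manifold.IsImmersion (𝓡 2) 𝓘(ℝ, E4) ∞ f)
    (hV : ∀ p, ∃ v₁ v₂, IsPrincipalBasis (tangentPlane f p) P (Real.cos θ) v₁ v₂ ∧
      v₁ ∈ V ∧ v₂ ∈ Vᗮ) {e : OpenPartialHomeomorph M (ℝ × ℝ)} (he : IsProductChart f V e) :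
    IsPrincipalFrame f P 0 θ e.source (coordField e (1, 0)) (coordField e (0, 1)) := by
  have key : ∀ q ∈ e.source, surfDiff f q (coordField e (1, 0) q) ∈ V ∧
      ‖surfDiff f q (coordField e (1, 0) q)‖ = 1 ∧ surfDiff f q (coordField e (0, 1) q) ∈ Vᗮ ∧
      ‖surfDiff f q (coordField e (0, 1) q)‖ = 1 := by
    intro q hq
    rw [he.surfDiff_coordField hf.contMDiff _ hq, he.surfDiff_coordField hf.contMDiff _ hq]
    exact he.split _ (e.map_source hq)
  refine ⟨he.isSmoothField _, he.isSmoothField _, fun q hq => ?_, fun q hq => ?_, fun q hq => ?_⟩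
  · obtain ⟨h1, h2, h3, h4⟩ := key q hq
    rw [orthonormal_vecCons_iff]
    refine ⟨h2, fun i => ?_, ?_⟩
    · simpa using h3 _ h1
    · rw [orthonormal_vecCons_iff]
      simp [h4]
  · obtain ⟨v₁, v₂, hb, hv₁, hv₂⟩ := hV q
    obtain ⟨h1, -⟩ := key q hq
    have hT := finrank_tangentPlane hf q
    have hm : surfDiff f q (coordField e (1, 0) q) ∈ tangentPlane f q := ⟨_, rfl⟩
    have h2 := Submodule.eq_inner_smul_add_inner_smul hT hb.mem₁ hb.mem₂ hb.norm₁ hb.norm₂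
      hb.inner_eq hm
    rw [real_inner_comm, real_inner_comm _ v₂, hv₂ _ h1, zero_smul, add_zero] at h2
    have h3 : surfDiff f q (coordField e (1, 0) q) ∈ P := h2 ▸ P.smul_mem _ hb.mem_plane
    refine ext_inner_right ℝ fun v' => ?_
    rw [inner_principalOperator, Real.cos_zero, one_pow, one_smul,
      ← P.inner_starProjection_left_eq_right,
      P.starProjection_eq_self_iff.mpr (P.starProjection_apply_mem _)]
    exact congrArg (fun z => ⟪z, (v' : E4)⟫) (P.starProjection_eq_self_iff.mpr h3)
  · obtain ⟨v₁, v₂, hb, hv₁, hv₂⟩ := hV q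
    obtain ⟨-, -, h1, -⟩ := key q hq
    have hT := finrank_tangentPlane hf q
    have hm : surfDiff f q (coordField e (0, 1) q) ∈ tangentPlane f q := ⟨_, rfl⟩
    have h2 := Submodule.eq_inner_smul_add_inner_smul hT hb.mem₁ hb.mem₂ hb.norm₁ hb.norm₂
      hb.inner_eq hm
    rw [h1 _ hv₁, zero_smul, zero_add] at h2
    refine ext_inner_right ℝ fun v' => ?_
    rw [inner_principalOperator]
    refine Eq.trans ?_ (real_inner_smul_left (surfDiff f q (coordField e (0, 1) q))
      (v' : E4) _).symm
    change ⟪P.starProjection (surfDiff f q (coordField e (0, 1) q)), P.starProjection (v' : E4)⟫ = _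
    rw [h2, map_smul, real_inner_smul_left, real_inner_smul_left,
      hb.inner_starProjection_starProjection hT v'.2]
    ring

end Frames

end

theorem mainTheorem3 {M : Type*} [TopologicalSpace M] [T2Space M] [SecondCountableTopology M]
    [ConnectedSpace M] [ChartedSpace (EuclideanSpace ℝ (Fin 2)) M] [IsManifold (𝓡 2) ∞ M]
    (f : M → E4) (hf : Manifold.IsImmersion (𝓡 2) 𝓘(ℝ, E4) ∞ f)
    (hcomplete : IsCompleteSurface f)
    (P : Submodule ℝ E4) (hP : Module.finrank ℝ P = 2)
    (θ₁ θ₂ : ℝ) (hangles : HasConstantPrincipalAngles f P θ₁ θ₂) (hθ₁ : θ₁ = 0)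
    (hgeod : ¬ IsTotallyGeodesic f) :
    (∀ p : M, ∃ (U : Set M) (T₁ T₂ : ∀ q : M, TangentSpace (𝓡 2) q),
      IsOpen U ∧ p ∈ U ∧ IsPrincipalFrame f P θ₁ θ₂ U T₁ T₂) ∧
    (∀ (U : Set M) (T₁ T₂ : ∀ q : M, TangentSpace (𝓡 2) q),
      IsOpen U → IsPrincipalFrame f P θ₁ θ₂ U T₁ T₂ →
        IsParallelOn f U T₁ ∧ IsParallelOn f U T₂) ∧
    IsExtrinsicProduct f := by
  subst hθ₁
  have hbasis := fun p => (hangles p).exists_isPrincipalBasis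
  have hC : 0 ≤ Real.cos θ₂ := by
    obtain ⟨v₁, v₂, h⟩ := hbasis (Classical.arbitrary M)
    exact h.norm_proj ▸ norm_nonneg _
  -- This is where the surface not being totally geodesic enters: `cos θ₂ = 1` would make every
  -- tangent plane equal to `P`.
  have hC1 : Real.cos θ₂ < 1 := by
    refine lt_of_le_of_ne (Real.cos_le_one θ₂) fun h1 => ?_
    refine hgeod (isTotallyGeodesic_of_tangentPlane_eq (P := P) fun p => ?_)
    obtain ⟨v₁, v₂, h⟩ := hbasis p
    rw [h1] at h
    exact h.eq_of_one (finrank_tangentPlane hf p) hP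
  obtain ⟨V, hV⟩ := exists_splitting hf hcomplete hP hC hC1 hbasis
  have hsplit : SplitsAlong f V := fun p => by
    obtain ⟨v₁, v₂, h, h1, h2⟩ := hV p
    exact ⟨⟨v₁, h.mem₁, h1, h.norm₁⟩, v₂, h.mem₂, h2, h.norm₂⟩
  refine ⟨fun p => ?_, fun U T₁ T₂ hU h => h.isParallelOn hf hC hC1 hV hU,
    hsplit.isExtrinsicProduct hf hcomplete⟩
  obtain ⟨e, he, hp, -⟩ := exists_isProductChart hf hsplit p
  exact ⟨e.source, _, _, e.open_source, hp, he.isPrincipalFrame hf hV⟩
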